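/- **Model.** Let $c,\beta,\delta>0$. Let $\bar J$ be a continuous-time Markov chain on $\{1,2,3\}$ with absorbing state $3$, jump intensities $\lambda_{ij}\ge 0$ ($i\in\{1,2\}$, $j\neq i$) and $\lambda_i=\sum_{j\ne i}\lambda_{ij}>0$, the states $1,2$ being transient; let $\pi_1,\pi_2\ge 0$ with $\pi_1+\pi_2=1$. The (observed) phase process $J$ follows $\bar J$; each time state $3$ is reached a claim occurs and the phase restarts at once in $i\in\{1,2\}$ with probability $\pi_i$, independently of the past. (So the interclaim times have a 2-order phase-type distribution.) The claim sizes are i.i.d. exponential with parameter $\beta$, independent of the phases. The surplus starts at $x\ge 0$, increases at the premium rate $c$, and decreases by the claims and by the dividends $D$ paid; ruin is the first time $\tau$ at which the surplus is negative. For $b=(b_1,b_2)$ with $b_1,b_2\ge 0$, the *phase-wise barrier strategy* $b$ does the following while the phase is $i$: it immediately pays out all capital above $b_i$, pays nothing while the surplus is below $b_i$, and pays out the premium income at rate $c$ while the surplus equals $b_i$. Its value functions are $$f_i^{b}(x)=\mathbb E\Big[\int_{[0,\tau)}e^{-\delta t}\,dD_t\ \Big|\ J_0=i,\ X_{0-}=x\Big],\qquad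 i=1,2,\ x\ge 0 .$$ Barriers $b^*=(b_1^*,b_2^*)\in[0,\infty)^2$ are called *optimal phase-wise barriers* if $f_i^{b}(x)\le f_i^{b^*}(x)$ for all $b\in[0,\infty)^2$, all $i\in\{1,2\}$ and all $0\le x\le b_i^*$. **Theorem.** Let $b^*$ be optimal phase-wise barriers and put $f_i^*=f_i^{b^*}$ for $i=1,2$ and $$f_3^*(x)=\beta e^{-\beta x}\int_0^x e^{\beta y}\big(\pi_1f_1^*(y)+\pi_2f_2^*(y)\big)\,dy .$$ Then $f_1^*$ and $f_2^*$ are differentiable on $[0,\infty)$ (from the right at $0$), and for every $x\ge 0$ and $i=1,2$, $$\max\Big\{c\,{f_i^*}'(x)+\sum_{j\in\{1,2,3\},\,j\ne i}\lambda_{ij}f_j^*(x)-(\lambda_i+\delta)f_i^*(x),\ 1-{f_i^*}'(x)\Big\}=0 .$$ -/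

import Mathlib

open MeasureTheory ProbabilityTheory Set
open scoped ENNReal

noncomputable section

/-- Data of the renewal risk model with `n`-order phase-type interclaim times and exponential
claims. `T` is the intensity matrix restricted to the `n` transient phases, `init` is the initial
law of the phase after each claim, `c` the premium rate, `β` the parameter of the claim law and
`δ` the discount rate. In the usual notation `λ_{ij} = T i j` for `j ≠ i`, `λ_i = - T i i`, and
`λ_{i,n+1} = - ∑ j, T i j` is the intensity of a claim in phase `i`. -/
structure PhaseModel (n : ℕ) where
  c : ℝ
  β : ℝ
  δ : ℝ
  T : Matrix (Fin n) (Fin n) ℝ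
  init : Fin n → ℝ
  c_pos : 0 < c
  β_pos : 0 < β
  δ_pos : 0 < δ
  offDiag_nonneg : ∀ i j, i ≠ j → 0 ≤ T i j
  diag_neg : ∀ i, T i i < 0
  exit_nonneg : ∀ i, 0 ≤ -∑ j, T i j
  /-- every phase is transient: the absorbing state is accessible from every phase -/
  transient : ∀ i, ∃ k, Relation.ReflTransGen (fun p q => p ≠ q ∧ 0 < T p q) i k ∧
    0 < -∑ j, T k j
  init_nonneg : ∀ i, 0 ≤ init i
  init_sum : ∑ i, init i = 1

namespace PhaseModel

variable {n : ℕ} (M : PhaseModel n)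

/-- `λ_i`, the total intensity of leaving phase `i`. -/
def leaveRate (i : Fin n) : ℝ := -M.T i i

/-- `λ_{i,n+1}`, the intensity of a claim (absorption) in phase `i`. -/
def claimRate (i : Fin n) : ℝ := -∑ j, M.T i j

/-- Probability that the jump out of phase `i` leads to phase `j` (`Sum.inl j`) or to the absorbing
state, i.e. to a claim (`Sum.inr ()`). -/
def jumpProb (i : Fin n) : Fin n ⊕ Unit → ℝ
  | Sum.inl j => if j = i then 0 else M.T i j / M.leaveRate i
  | Sum.inr _ => M.claimRate i / M.leaveRate i

/-- Law of the target of the jump out of phase `i`. -/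
def jumpLaw (i : Fin n) : Measure (Fin n ⊕ Unit) :=
  ∑ o, ENNReal.ofReal (M.jumpProb i o) • Measure.dirac o

/-- Law of the phase in which the phase process restarts after a claim. -/
def initLaw : Measure (Fin n) :=
  ∑ i, ENNReal.ofReal (M.init i) • Measure.dirac i

theorem leaveRate_pos (i : Fin n) : 0 < M.leaveRate i := by
  have := M.diag_neg i
  unfold leaveRate
  linarith

theorem jumpProb_nonneg (i : Fin n) (o : Fin n ⊕ Unit) : 0 ≤ M.jumpProb i o := by
  have h := M.leaveRate_pos i
  rcases o with j | _
  · by_cases hj : j = i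
    · simp [jumpProb, hj]
    · simp only [jumpProb, hj, if_false]
      exact div_nonneg (M.offDiag_nonneg i j (Ne.symm hj)) h.le
  · exact div_nonneg (M.exit_nonneg i) h.le

theorem jumpProb_sum (i : Fin n) : ∑ o, M.jumpProb i o = 1 := by
  have h := M.leaveRate_pos i
  have h1 : ∀ j, M.jumpProb i (Sum.inl j)
      = M.T i j / M.leaveRate i - (if j = i then M.T i i / M.leaveRate i else 0) := by
    intro j
    by_cases hj : j = i
    · subst hj
      simp [jumpProb]
    · simp [jumpProb, hj]
  rw [Fintype.sum_sum_type]
  simp only [h1, Finset.sum_sub_distrib, Finset.sum_ite_eq', Finset.mem_univ, if_true,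
    ← Finset.sum_div]
  simp only [jumpProb, Finset.univ_unique, Finset.sum_singleton, claimRate]
  field_simp
  unfold leaveRate
  ring

instance (i : Fin n) : IsProbabilityMeasure (M.jumpLaw i) := by
  constructor
  simp only [jumpLaw, Measure.coe_finsetSum, Finset.sum_apply, Measure.smul_apply, measure_univ,
    smul_eq_mul, mul_one]
  rw [← ENNReal.ofReal_sum_of_nonneg (fun o _ => M.jumpProb_nonneg i o), M.jumpProb_sum,
    ENNReal.ofReal_one]

instance : IsProbabilityMeasure M.initLaw := by
  constructor
  simp only [initLaw, Measure.coe_finsetSum, Finset.sum_apply, Measure.smul_apply, measure_univ,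
    smul_eq_mul, mul_one]
  rw [← ENNReal.ofReal_sum_of_nonneg (fun i _ => M.init_nonneg i), M.init_sum,
    ENNReal.ofReal_one]

instance (i : Fin n) : IsProbabilityMeasure (expMeasure (M.leaveRate i)) :=
  isProbabilityMeasure_expMeasure (M.leaveRate_pos i)

instance : IsProbabilityMeasure (expMeasure M.β) :=
  isProbabilityMeasure_expMeasure M.β_pos

/-- The randomness of one sojourn of the phase process: for every phase a candidate sojourn time
and a candidate jump target (only those of the current phase are used), the phase of restart and
the claim size (only used if the jump is a claim). -/
abbrev Noise (n : ℕ) : Type := (Fin n → ℝ) × (Fin n → Fin n ⊕ Unit) × Fin n × ℝ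

/-- Law of the randomness of one sojourn: independent components, sojourn times in phase `i`
exponential of parameter `λ_i`, jump targets with probabilities `λ_{ij} / λ_i`, restart phase
with law `init`, claim size exponential of parameter `β`. -/
def noiseLaw : Measure (Noise n) :=
  (Measure.pi fun i => expMeasure (M.leaveRate i)).prod
    ((Measure.pi fun i => M.jumpLaw i).prod (M.initLaw.prod (expMeasure M.β)))

instance : IsProbabilityMeasure M.noiseLaw := by
  unfold noiseLaw
  infer_instance

/-- The probability measure of the model: independent sojourns. -/
def law : Measure (ℕ → Noise n) := Measure.infinitePi fun _ => M.noiseLaw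

/-- Length of the current sojourn, in phase `i`. -/
def sojourn (i : Fin n) (w : Noise n) : ℝ := w.1 i

/-- Phase after the jump out of phase `i`. -/
def nextPhase (i : Fin n) (w : Noise n) : Fin n :=
  Sum.elim (fun j => j) (fun _ => w.2.2.1) (w.2.1 i)

/-- Claim paid at the jump out of phase `i`: zero if the jump is to another phase. -/
def claim (i : Fin n) (w : Noise n) : ℝ :=
  Sum.elim (fun _ => 0) (fun _ => w.2.2.2) (w.2.1 i)

/-- Surplus under the phase-wise barrier strategy `b`, at the time `s > 0` after the start of a
sojourn in phase `i` that starts with capital `x`: capital above `b i` is paid out at once, then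
premiums are collected until the level `b i` is reached, where they are paid out. -/
def surplus (b : Fin n → ℝ) (i : Fin n) (x s : ℝ) : ℝ := min (x + M.c * s) (b i)

/-- Phase and capital at the start of the `k`-th sojourn (after the claim, if there was one, and
before any dividend of this sojourn), for the initial phase `i` and initial capital `x`. -/
def state (b : Fin n → ℝ) (i : Fin n) (x : ℝ) (w : ℕ → Noise n) : ℕ → Fin n × ℝ
  | 0 => (i, x)
  | k + 1 =>
    let z := state b i x w k
    (nextPhase z.1 (w k), M.surplus b z.1 z.2 (sojourn z.1 (w k)) - claim z.1 (w k))

/-- The time at which the `k`-th sojourn starts. -/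
def jumpTime (b : Fin n → ℝ) (i : Fin n) (x : ℝ) (w : ℕ → Noise n) (k : ℕ) : ℝ :=
  ∑ m ∈ Finset.range k, sojourn (M.state b i x w m).1 (w m)

/-- Dividends paid during a sojourn in phase `i` on the time interval from `s` to `t` that starts
with capital `x`, as a measure on the time axis: a lump sum at time `s`, and then
the premium rate `c` as long as the surplus is at the barrier. -/
def sojournDividends (b : Fin n → ℝ) (i : Fin n) (x s t : ℝ) : Measure ℝ :=
  ENNReal.ofReal (x - b i) • Measure.dirac s +
    ENNReal.ofReal M.c • volume.restrict {u | u ∈ Ioo s t ∧ M.surplus b i x (u - s) = b i}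

/-- The measure `dD` on the time axis of the dividends that the phase-wise barrier strategy `b` pays
strictly before ruin. Since the surplus decreases only by claims, ruin is the first time at
which the capital at the start of a sojourn is negative. -/
def dividends (b : Fin n → ℝ) (i : Fin n) (x : ℝ) (w : ℕ → Noise n) : Measure ℝ :=
  open Classical in
  Measure.sum fun k : ℕ =>
    if ∀ m ≤ k, 0 ≤ (M.state b i x w m).2 then
      M.sojournDividends b (M.state b i x w k).1 (M.state b i x w k).2
        (M.jumpTime b i x w k) (M.jumpTime b i x w (k + 1))
    else 0

/-- The value function `f_i(x)` of the phase-wise barrier strategy `b`: the expectation of the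
integral of `exp (-δ t)` with respect to `dD` before ruin. It is finite for `0 ≤ x`, as the
cumulative dividends until time `t` are at most `x + c t` and `0 < δ`. -/
def value (b : Fin n → ℝ) (i : Fin n) (x : ℝ) : ℝ :=
  (∫⁻ w, ∫⁻ t, ENNReal.ofReal (Real.exp (-M.δ * t)) ∂(M.dividends b i x w) ∂M.law).toReal

/-- The phase-wise barriers `b` are optimal among all phase-wise barriers: in every phase `i`, for
every initial capital up to the barrier `b i`, no phase-wise barrier strategy has a larger value. -/
def IsOptimalBarrier (b : Fin n → ℝ) : Prop :=
  (∀ i, 0 ≤ b i) ∧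
    ∀ b' : Fin n → ℝ, (∀ i, 0 ≤ b' i) → ∀ i, ∀ x ∈ Icc 0 (b i), M.value b' i x ≤ M.value b i x

/-- The claim term `f_{n+1}(x) = β e^{-β x} ∫_0^x e^{β y} ∑ i, π_i f_i(y) dy`. -/
def claimTerm (f : Fin n → ℝ → ℝ) (x : ℝ) : ℝ :=
  M.β * Real.exp (-M.β * x) * ∫ y in (0 : ℝ)..x, Real.exp (M.β * y) * ∑ i, M.init i * f i y

end PhaseModel

end

/-! Conditioning on the first sojourn gives a renewal equation for the value functions
(`eValue_renewal`). Integrating out the exponential sojourn and replacing time by capital as the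
variable shows that they are differentiable, solve c f_i' + (jump terms) = 0 on [0, b_i] and have
slope 1 above b_i. The one-sided slopes agree at b_i because exactly the premium rate is paid out
there (`exists_deriv_value`).

Optimality enters only through moving a single barrier b_i by ε. The difference of the new and the
old value functions satisfies an integro-differential inequality, and a minimum principle
(`nonneg_of_supersolution`) makes it nonnegative. It would be positive at b_i if the generator taken
with slope 1 were positive just above b_i (`not_jumpGen_pos`), or if the slope were below 1 just
below b_i (`not_deriv_lt_one`). Hence λ_ij f_j'(b_i) + λ_i3 f_3'(b_i) ≤ λ_i + δ, with equality when
b_i > 0.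

The rest is the study of a linear system (`hjb_of_ordered_barriers`). Let b_1 ≤ b_2 and H = f_3',
and let p_1, p_2, q be the negated derivatives of f_1', f_2', H below the barriers. In the unknowns
p_i and q - p_i the system, read downwards, has nonnegative off-diagonal coefficients, because π_1 +
π_2 = 1. So nonnegativity propagates from b_2 to b_1 and from b_1 to 0
(`nonneg_of_backward_metzler`), the first-order conditions supplying the signs at the barriers. The
slopes therefore decrease towards the barrier and are at least 1. The generator with slope 1
vanishes at its own barrier and does not increase above it: between the barriers because f_2' and H
decrease, above both because H' = β(1 - H). -/

noncomputable section

/-! ### Splitting off the first coordinate of an i.i.d. sequence. -/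

/-- Prepend a value to a sequence. -/
def seqCons {α : Type*} (z : α) (w : ℕ → α) : ℕ → α
  | 0 => z
  | k + 1 => w k

theorem measurable_seqCons {α : Type*} [MeasurableSpace α] :
    Measurable fun p : α × (ℕ → α) => seqCons p.1 p.2 := by
  rw [measurable_pi_iff]
  rintro (_ | k)
  · exact measurable_fst
  · exact (measurable_pi_apply k).comp measurable_snd

/-- An infinite product measure is determined by boxes with finitely many constraints, and the
preimage of such a box is again a product. -/
theorem map_seqCons_infinitePi {α : Type*} [MeasurableSpace α] (μ : Measure α)
    [IsProbabilityMeasure μ] :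
    (μ.prod (Measure.infinitePi fun _ : ℕ => μ)).map (fun p => seqCons p.1 p.2)
      = Measure.infinitePi fun _ : ℕ => μ := by
  apply Measure.eq_infinitePi
  intro s t ht
  rw [Measure.map_apply measurable_seqCons (MeasurableSet.pi s.countable_toSet fun i _ => ht i)]
  classical
  let t' : ℕ → Set α := fun i => if i ∈ s then t i else univ
  have ht' : ∀ i, MeasurableSet (t' i) := by
    intro i
    by_cases h : i ∈ s <;> simp [t', h, ht]
  have hset : (fun p : α × (ℕ → α) => seqCons p.1 p.2) ⁻¹' (s : Set ℕ).pi t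
      = t' 0 ×ˢ (univ : Set ℕ).pi fun k => t' (k + 1) := by
    ext ⟨z, w⟩
    simp only [mem_preimage, Set.mem_pi, Finset.mem_coe, mem_prod, mem_univ, forall_true_left]
    constructor
    · intro h
      refine ⟨?_, fun k => ?_⟩
      · by_cases h0 : 0 ∈ s
        · simpa [t', h0, seqCons] using h 0 h0
        · simp [t', h0]
      · by_cases h0 : k + 1 ∈ s
        · simpa [t', h0, seqCons] using h (k + 1) h0
        · simp [t', h0]
    · rintro ⟨h0, h1⟩ (_ | k) hk
      · simpa [t', hk, seqCons] using h0
      · simpa [t', hk, seqCons] using h1 k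
  rw [hset, Measure.prod_prod, Measure.infinitePi_pi_univ _ (fun k => ht' (k + 1))]
  have h1 : ∀ k, k ∉ s → μ (t' k) = 1 := by
    intro k hk
    simp [t', hk]
  -- All constraints sit below N, so the infinite product is a finite one; the range N + 1 makes
  -- room for the factor of coordinate 0.
  obtain ⟨N, hN⟩ := s.exists_nat_subset_range
  have hN' : ∀ k, k ∉ Finset.range N → μ (t' (k + 1)) = 1 := by
    intro k hk
    refine h1 _ fun h => hk ?_
    have := Finset.mem_range.1 (hN h)
    exact Finset.mem_range.2 (by omega)
  rw [tprod_eq_prod hN', mul_comm, ← Finset.prod_range_succ' (fun k => μ (t' k)),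
    ← Finset.prod_subset (hN.trans (Finset.range_mono (Nat.le_succ N))) (fun k _ hk => h1 k hk)]
  refine Finset.prod_congr rfl fun k hk => ?_
  simp [t', hk]

instance {α β : Type*} [MeasurableSpace α] [MeasurableSpace β] [MeasurableSingletonClass α]
    [MeasurableSingletonClass β] : MeasurableSingletonClass (α ⊕ β) where
  measurableSet_singleton := by
    rintro (a | a)
    · simpa using (measurableSet_singleton a).inl_image (β := β)
    · simpa using (measurableSet_singleton a).inr_image (α := α)

theorem lintegral_infinitePi_seqCons {α : Type*} [MeasurableSpace α] (μ : Measure α)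
    [IsProbabilityMeasure μ] {F : (ℕ → α) → ℝ≥0∞} (hF : Measurable F) :
    ∫⁻ w, F w ∂(Measure.infinitePi fun _ : ℕ => μ)
      = ∫⁻ z, ∫⁻ w, F (seqCons z w) ∂(Measure.infinitePi fun _ : ℕ => μ) ∂μ := by
  conv_lhs => rw [← map_seqCons_infinitePi μ]
  rw [lintegral_map hF measurable_seqCons,
    lintegral_prod (fun p : α × (ℕ → α) => F (seqCons p.1 p.2))
      (hF.comp measurable_seqCons).aemeasurable]

/-! ### The renewal equation at the first jump. -/

namespace PhaseModel

variable {n : ℕ} (M : PhaseModel n)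

instance : IsProbabilityMeasure M.law := by
  unfold law
  infer_instance

/-- Discounted dividends of a sojourn of length `τ` in phase `i` that starts at time `0` with
capital `x`. -/
def sojournReward (b : Fin n → ℝ) (i : Fin n) (x τ : ℝ) : ℝ≥0∞ :=
  ∫⁻ t, ENNReal.ofReal (Real.exp (-M.δ * t)) ∂(M.sojournDividends b i x 0 τ)

theorem sojournReward_eq (b : Fin n → ℝ) (i : Fin n) (x τ : ℝ) :
    M.sojournReward b i x τ = ENNReal.ofReal (x - b i) + ENNReal.ofReal M.c *
      ∫⁻ u, {u | u ∈ Ioo 0 τ ∧ M.surplus b i x u = b i}.indicator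
        (fun u => ENNReal.ofReal (Real.exp (-M.δ * u))) u := by
  have hm : MeasurableSet {u | u ∈ Ioo 0 τ ∧ M.surplus b i x (u - 0) = b i} := by
    refine measurableSet_Ioo.inter ?_
    refine measurableSet_eq_fun ?_ measurable_const
    unfold surplus
    fun_prop
  rw [sojournReward, sojournDividends, lintegral_add_measure, lintegral_smul_measure,
    lintegral_smul_measure, lintegral_dirac' _ (by fun_prop), ← lintegral_indicator hm]
  simp

/-- The payments depend only on the time since the start of the sojourn, so translating by s leaves
nothing but a discount factor. -/
theorem lintegral_sojournDividends (b : Fin n → ℝ) (i : Fin n) (x s τ : ℝ) :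
    ∫⁻ t, ENNReal.ofReal (Real.exp (-M.δ * t)) ∂(M.sojournDividends b i x s (s + τ))
      = ENNReal.ofReal (Real.exp (-M.δ * s)) * M.sojournReward b i x τ := by
  have hm : MeasurableSet {u | u ∈ Ioo s (s + τ) ∧ M.surplus b i x (u - s) = b i} := by
    refine measurableSet_Ioo.inter ?_
    refine measurableSet_eq_fun ?_ measurable_const
    unfold surplus
    fun_prop
  rw [sojournReward_eq, sojournDividends, lintegral_add_measure, lintegral_smul_measure,
    lintegral_smul_measure, lintegral_dirac' _ (by fun_prop), ← lintegral_indicator hm,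
    ← lintegral_add_right_eq_self _ s, mul_add, smul_eq_mul, smul_eq_mul, mul_comm]
  congr 1
  rw [mul_left_comm, ← lintegral_const_mul' (ENNReal.ofReal (Real.exp (-M.δ * s))) _
    ENNReal.ofReal_ne_top]
  congr 1
  refine lintegral_congr fun u => ?_
  by_cases hu : u ∈ {u | u ∈ Ioo 0 τ ∧ M.surplus b i x u = b i}
  · have hu' : u + s ∈ {u | u ∈ Ioo s (s + τ) ∧ M.surplus b i x (u - s) = b i} := by
      simp only [mem_ofPred_eq, mem_Ioo, add_sub_cancel_right] at hu ⊢
      exact ⟨⟨by linarith [hu.1.1], by linarith [hu.1.2]⟩, hu.2⟩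
    rw [indicator_of_mem hu, indicator_of_mem hu', ← ENNReal.ofReal_mul (Real.exp_pos _).le,
      ← Real.exp_add]
    congr 2
    ring
  · have hu' : u + s ∉ {u | u ∈ Ioo s (s + τ) ∧ M.surplus b i x (u - s) = b i} := by
      simp only [mem_ofPred_eq, mem_Ioo, add_sub_cancel_right] at hu ⊢
      intro h
      exact hu ⟨⟨by linarith [h.1.1], by linarith [h.1.2]⟩, h.2⟩
    rw [indicator_of_notMem hu, indicator_of_notMem hu', mul_zero]

theorem measurable_sojournReward (b : Fin n → ℝ) (i : Fin n) :
    Measurable fun p : ℝ × ℝ => M.sojournReward b i p.1 p.2 := by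
  simp only [sojournReward_eq]
  refine Measurable.add (measurable_fst.sub_const _).ennreal_ofReal (Measurable.const_mul ?_ _)
  refine Measurable.lintegral_prod_right (f := fun (p : ℝ × ℝ) u => {u | u ∈ Ioo 0 p.2 ∧
    M.surplus b i p.1 u = b i}.indicator (fun u => ENNReal.ofReal (Real.exp (-M.δ * u))) u) ?_
  have hm : MeasurableSet {q : (ℝ × ℝ) × ℝ | (0 < q.2 ∧ q.2 < q.1.2) ∧
      M.surplus b i q.1.1 q.2 = b i} := by
    refine ((measurableSet_lt measurable_const measurable_snd).inter
      (measurableSet_lt measurable_snd (by fun_prop))).inter ?_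
    refine measurableSet_eq_fun ?_ measurable_const
    unfold surplus
    fun_prop
  exact Measurable.indicator (f := fun q : (ℝ × ℝ) × ℝ => ENNReal.ofReal (Real.exp (-M.δ * q.2)))
    (by fun_prop) hm

/-- Discounted dividends of the `k`-th sojourn, before ruin. -/
def reward (b : Fin n → ℝ) (i : Fin n) (x : ℝ) (w : ℕ → Noise n) (k : ℕ) : ℝ≥0∞ :=
  open Classical in
  if ∀ m ≤ k, 0 ≤ (M.state b i x w m).2 then
    ENNReal.ofReal (Real.exp (-M.δ * M.jumpTime b i x w k)) *
      M.sojournReward b (M.state b i x w k).1 (M.state b i x w k).2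
        (sojourn (M.state b i x w k).1 (w k))
  else 0

theorem lintegral_dividends (b : Fin n → ℝ) (i : Fin n) (x : ℝ) (w : ℕ → Noise n) :
    ∫⁻ t, ENNReal.ofReal (Real.exp (-M.δ * t)) ∂(M.dividends b i x w)
      = ∑' k, M.reward b i x w k := by
  rw [dividends, lintegral_sum_measure]
  refine tsum_congr fun k => ?_
  unfold reward
  split_ifs with h
  · have : M.jumpTime b i x w (k + 1)
        = M.jumpTime b i x w k + sojourn (M.state b i x w k).1 (w k) := by
      simp [jumpTime, Finset.sum_range_succ]
    rw [this, lintegral_sojournDividends]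
  · simp

/-- Pathwise Markov property: after the first sojourn the same recursion runs from the post-jump
phase and capital. -/
theorem state_seqCons (b : Fin n → ℝ) (i : Fin n) (x : ℝ) (z : Noise n) (w : ℕ → Noise n) (k : ℕ) :
    M.state b i x (seqCons z w) (k + 1)
      = M.state b (nextPhase i z) (M.surplus b i x (sojourn i z) - claim i z) w k := by
  induction k with
  | zero => rfl
  | succ k ih =>
    rw [state, ih]
    rfl

theorem jumpTime_seqCons (b : Fin n → ℝ) (i : Fin n) (x : ℝ) (z : Noise n) (w : ℕ → Noise n)
    (k : ℕ) :
    M.jumpTime b i x (seqCons z w) (k + 1) = sojourn i z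
      + M.jumpTime b (nextPhase i z) (M.surplus b i x (sojourn i z) - claim i z) w k := by
  rw [jumpTime, Finset.sum_range_succ', add_comm]
  simp only [state_seqCons]
  rfl

theorem reward_zero (b : Fin n → ℝ) (i : Fin n) {x : ℝ} (hx : 0 ≤ x) (w : ℕ → Noise n) :
    M.reward b i x w 0 = M.sojournReward b i x (sojourn i (w 0)) := by
  simp [reward, state, jumpTime, hx]

theorem reward_of_neg (b : Fin n → ℝ) (i : Fin n) {x : ℝ} (hx : x < 0) (w : ℕ → Noise n) (k : ℕ) :
    M.reward b i x w k = 0 := by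
  rw [reward, if_neg]
  intro h
  exact absurd (h 0 (Nat.zero_le k)) (not_le.mpr hx)

theorem reward_seqCons (b : Fin n → ℝ) (i : Fin n) {x : ℝ} (hx : 0 ≤ x) (z : Noise n)
    (w : ℕ → Noise n) (k : ℕ) :
    M.reward b i x (seqCons z w) (k + 1) = ENNReal.ofReal (Real.exp (-M.δ * sojourn i z)) *
      M.reward b (nextPhase i z) (M.surplus b i x (sojourn i z) - claim i z) w k := by
  have hiff : (∀ m ≤ k + 1, 0 ≤ (M.state b i x (seqCons z w) m).2) ↔
      ∀ m ≤ k, 0 ≤ (M.state b (nextPhase i z)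
        (M.surplus b i x (sojourn i z) - claim i z) w m).2 := by
    constructor
    · intro h m hm
      rw [← state_seqCons]
      exact h (m + 1) (by omega)
    · rintro h (_ | m) hm
      · exact hx
      · rw [state_seqCons]
        exact h m (by omega)
  unfold reward
  by_cases h : ∀ m ≤ k, 0 ≤ (M.state b (nextPhase i z)
      (M.surplus b i x (sojourn i z) - claim i z) w m).2
  · rw [if_pos h, if_pos (hiff.2 h), state_seqCons, jumpTime_seqCons, mul_add, Real.exp_add,
      ENNReal.ofReal_mul (Real.exp_pos _).le, mul_assoc]
    rfl
  · rw [if_neg h, if_neg (fun h' => h (hiff.1 h')), mul_zero]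

theorem measurable_sojourn : Measurable fun p : Fin n × Noise n => sojourn p.1 p.2 :=
  measurable_from_prod_countable_right fun i => by
    change Measurable fun w : Noise n => w.1 i
    fun_prop

theorem measurable_nextPhase : Measurable fun p : Fin n × Noise n => nextPhase p.1 p.2 :=
  measurable_from_prod_countable_right fun i => by
    have h : Measurable fun q : (Fin n ⊕ Unit) × Fin n => Sum.elim (fun j => j) (fun _ => q.2) q.1 :=
      measurable_from_prod_countable_right fun o => by
        rcases o with j | _
        · exact measurable_const
        · exact measurable_id
    exact h.comp (f := fun w : Noise n => (w.2.1 i, w.2.2.1)) (by fun_prop)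

theorem measurable_claim : Measurable fun p : Fin n × Noise n => claim p.1 p.2 :=
  measurable_from_prod_countable_right fun i => by
    have h : Measurable fun q : (Fin n ⊕ Unit) × ℝ => Sum.elim (fun _ => 0) (fun _ => q.2) q.1 :=
      measurable_from_prod_countable_right fun o => by
        rcases o with j | _
        · exact measurable_const
        · exact measurable_id
    exact h.comp (f := fun w : Noise n => (w.2.1 i, w.2.2.2)) (by fun_prop)

theorem measurable_surplus (b : Fin n → ℝ) :
    Measurable fun p : Fin n × ℝ × ℝ => M.surplus b p.1 p.2.1 p.2.2 :=
  measurable_from_prod_countable_right fun i => by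
    unfold surplus
    fun_prop

theorem measurable_state (b : Fin n → ℝ) (k : ℕ) :
    Measurable fun p : (Fin n × ℝ) × (ℕ → Noise n) => M.state b p.1.1 p.1.2 p.2 k := by
  induction k with
  | zero => exact measurable_fst
  | succ k ih =>
    have hw : Measurable fun p : (Fin n × ℝ) × (ℕ → Noise n) =>
        ((M.state b p.1.1 p.1.2 p.2 k).1, p.2 k) := by fun_prop
    refine Measurable.prodMk (measurable_nextPhase.comp hw) (Measurable.sub ?_
      (measurable_claim.comp hw))
    exact (M.measurable_surplus b).comp (ih.fst.prodMk (ih.snd.prodMk (measurable_sojourn.comp hw)))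

theorem measurable_jumpTime (b : Fin n → ℝ) (k : ℕ) :
    Measurable fun p : (Fin n × ℝ) × (ℕ → Noise n) => M.jumpTime b p.1.1 p.1.2 p.2 k := by
  unfold jumpTime
  refine Finset.measurable_fun_sum _ fun m _ => ?_
  have hs := M.measurable_state b m
  exact measurable_sojourn.comp (f := fun p : (Fin n × ℝ) × (ℕ → Noise n) =>
    ((M.state b p.1.1 p.1.2 p.2 m).1, p.2 m)) (by fun_prop)

theorem measurable_reward (b : Fin n → ℝ) (k : ℕ) :
    Measurable fun p : (Fin n × ℝ) × (ℕ → Noise n) => M.reward b p.1.1 p.1.2 p.2 k := by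
  classical
  unfold reward
  have hs := M.measurable_state b k
  refine Measurable.ite ?_ (Measurable.mul ?_ ?_) measurable_const
  · have : {a : (Fin n × ℝ) × (ℕ → Noise n) | ∀ m ≤ k, 0 ≤ (M.state b a.1.1 a.1.2 a.2 m).2}
        = ⋂ m ∈ Finset.range (k + 1), {a | 0 ≤ (M.state b a.1.1 a.1.2 a.2 m).2} := by
      ext a
      simp
    rw [this]
    exact Finset.measurableSet_biInter _ fun m _ =>
      measurableSet_le measurable_const (M.measurable_state b m).snd
  · exact (Real.measurable_exp.comp ((M.measurable_jumpTime b k).const_mul (-M.δ))).ennreal_ofReal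
  · have h : Measurable fun q : Fin n × ℝ × ℝ => M.sojournReward b q.1 q.2.1 q.2.2 :=
      measurable_from_prod_countable_right fun i => M.measurable_sojournReward b i
    have hw : Measurable fun p : (Fin n × ℝ) × (ℕ → Noise n) =>
        ((M.state b p.1.1 p.1.2 p.2 k).1, p.2 k) :=
      hs.fst.prodMk ((measurable_pi_apply k).comp measurable_snd)
    have hj : Measurable fun p : (Fin n × ℝ) × (ℕ → Noise n) =>
        sojourn (M.state b p.1.1 p.1.2 p.2 k).1 (p.2 k) := measurable_sojourn.comp hw
    exact h.comp (f := fun p : (Fin n × ℝ) × (ℕ → Noise n) => ((M.state b p.1.1 p.1.2 p.2 k).1,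
      (M.state b p.1.1 p.1.2 p.2 k).2, sojourn (M.state b p.1.1 p.1.2 p.2 k).1 (p.2 k)))
      (hs.fst.prodMk (hs.snd.prodMk hj))

/-- Expected discounted dividends of the first `m` sojourns. -/
def partialValue (b : Fin n → ℝ) (m : ℕ) (i : Fin n) (x : ℝ) : ℝ≥0∞ :=
  ∫⁻ w, ∑ k ∈ Finset.range m, M.reward b i x w k ∂M.law

/-- The value function with values in `ℝ≥0∞`. -/
def eValue (b : Fin n → ℝ) (i : Fin n) (x : ℝ) : ℝ≥0∞ :=
  ∫⁻ w, ∑' k, M.reward b i x w k ∂M.law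

theorem value_eq (b : Fin n → ℝ) (i : Fin n) (x : ℝ) :
    M.value b i x = (M.eValue b i x).toReal := by
  simp only [value, eValue, lintegral_dividends]

theorem measurable_reward' (b : Fin n → ℝ) (i : Fin n) (x : ℝ) (k : ℕ) :
    Measurable fun w => M.reward b i x w k :=
  (M.measurable_reward b k).comp (f := fun w => ((i, x), w)) (by fun_prop)

theorem eValue_eq_iSup (b : Fin n → ℝ) (i : Fin n) (x : ℝ) :
    M.eValue b i x = ⨆ m, M.partialValue b m i x := by
  unfold eValue partialValue
  rw [← lintegral_iSup]
  · simp only [ENNReal.tsum_eq_iSup_nat]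
  · intro m
    exact Finset.measurable_fun_sum _ fun k _ => M.measurable_reward' b i x k
  · intro m m' h w
    exact Finset.sum_le_sum_of_subset (Finset.range_mono h)

theorem measurable_eValue (b : Fin n → ℝ) :
    Measurable fun p : Fin n × ℝ => M.eValue b p.1 p.2 := by
  unfold eValue
  refine Measurable.lintegral_prod_right (f := fun (p : Fin n × ℝ) w => ∑' k, M.reward b p.1 p.2 w k) ?_
  exact Measurable.tsum fun k => M.measurable_reward b k

theorem eValue_of_neg (b : Fin n → ℝ) (i : Fin n) {x : ℝ} (hx : x < 0) : M.eValue b i x = 0 := by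
  simp [eValue, M.reward_of_neg b i hx]

/-- The truncated recursion serves the finiteness proof: the renewal equation for `eValue` alone is
compatible with the value ∞, whereas this one allows an induction from 0. -/
theorem partialValue_succ (b : Fin n → ℝ) (m : ℕ) (i : Fin n) {x : ℝ} (hx : 0 ≤ x) :
    M.partialValue b (m + 1) i x = ∫⁻ z, (M.sojournReward b i x (sojourn i z) +
      ENNReal.ofReal (Real.exp (-M.δ * sojourn i z)) * M.partialValue b m (nextPhase i z)
        (M.surplus b i x (sojourn i z) - claim i z)) ∂M.noiseLaw := by
  unfold partialValue law
  rw [lintegral_infinitePi_seqCons _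
    (Finset.measurable_fun_sum _ fun k _ => M.measurable_reward' b i x k)]
  refine lintegral_congr fun z => ?_
  simp only [Finset.sum_range_succ', M.reward_zero b i hx, M.reward_seqCons b i hx,
    ← Finset.mul_sum]
  have hs : ∀ w, M.sojournReward b i x (sojourn i (seqCons z w 0))
      = M.sojournReward b i x (sojourn i z) := fun _ => rfl
  simp only [hs]
  rw [lintegral_add_right _ measurable_const, lintegral_const_mul' _ _ ENNReal.ofReal_ne_top,
    add_comm]
  simp

theorem eValue_renewal (b : Fin n → ℝ) (i : Fin n) {x : ℝ} (hx : 0 ≤ x) :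
    M.eValue b i x = ∫⁻ z, (M.sojournReward b i x (sojourn i z) +
      ENNReal.ofReal (Real.exp (-M.δ * sojourn i z)) * M.eValue b (nextPhase i z)
        (M.surplus b i x (sojourn i z) - claim i z)) ∂M.noiseLaw := by
  unfold eValue law
  rw [lintegral_infinitePi_seqCons _
    (Measurable.tsum fun k => M.measurable_reward' b i x k)]
  refine lintegral_congr fun z => ?_
  simp only [tsum_eq_zero_add' (f := M.reward b i x _) ENNReal.summable, M.reward_zero b i hx,
    M.reward_seqCons b i hx, ENNReal.tsum_mul_left]
  have hs : ∀ w, M.sojournReward b i x (sojourn i (seqCons z w 0))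
      = M.sojournReward b i x (sojourn i z) := fun _ => rfl
  simp only [hs]
  rw [lintegral_add_left measurable_const, lintegral_const_mul' _ _ ENNReal.ofReal_ne_top]
  simp

end PhaseModel

/-! ### Finiteness of the value and its integral equation in time. -/

theorem lintegral_expMeasure {r : ℝ} {F : ℝ → ℝ≥0∞} (hF : Measurable F) :
    ∫⁻ s, F s ∂(expMeasure r)
      = ∫⁻ s in Ioi 0, ENNReal.ofReal (r * Real.exp (-(r * s))) * F s := by
  have h : expMeasure r = volume.withDensity (exponentialPDF r) := rfl
  rw [h, lintegral_withDensity_eq_lintegral_mul _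
    (f := exponentialPDF r) (measurable_exponentialPDFReal r).ennreal_ofReal hF, ← lintegral_indicator measurableSet_Ioi]
  refine lintegral_congr_ae ?_
  filter_upwards [compl_mem_ae_iff.2 (measure_singleton (0 : ℝ))] with s hs
  rcases lt_or_gt_of_ne (show s ≠ 0 from hs) with h0 | h0
  · rw [indicator_of_notMem (by simpa using h0.le), Pi.mul_apply, exponentialPDF_of_neg h0, zero_mul]
  · rw [indicator_of_mem (by simpa using h0), Pi.mul_apply, exponentialPDF_of_nonneg h0.le]

theorem lintegral_exp_neg_mul_Ioi {a : ℝ} (ha : 0 < a) (t : ℝ) :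
    ∫⁻ s in Ioi t, ENNReal.ofReal (Real.exp (-a * s)) = ENNReal.ofReal (Real.exp (-a * t) / a) := by
  rw [← ofReal_integral_eq_lintegral_ofReal (integrableOn_exp_mul_Ioi (by linarith) t)
    (Filter.Eventually.of_forall fun s => (Real.exp_pos _).le), integral_exp_mul_Ioi (by linarith),
    neg_div_neg_eq]

namespace PhaseModel

variable {n : ℕ} (M : PhaseModel n)

theorem lintegral_jumpLaw (i : Fin n) (F : Fin n ⊕ Unit → ℝ≥0∞) :
    ∫⁻ o, F o ∂M.jumpLaw i = ∑ o, ENNReal.ofReal (M.jumpProb i o) * F o := by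
  simp [jumpLaw, lintegral_finsetSum_measure]

theorem lintegral_initLaw (F : Fin n → ℝ≥0∞) :
    ∫⁻ j, F j ∂M.initLaw = ∑ j, ENNReal.ofReal (M.init j) * F j := by
  simp [initLaw, lintegral_finsetSum_measure]

theorem lintegral_noiseLaw (i : Fin n) {F : ℝ × (Fin n ⊕ Unit) × Fin n × ℝ → ℝ≥0∞}
    (hF : Measurable F) :
    ∫⁻ z, F (z.1 i, z.2.1 i, z.2.2.1, z.2.2.2) ∂M.noiseLaw
      = ∫⁻ s, ∑ o, ENNReal.ofReal (M.jumpProb i o) * ∑ j, ENNReal.ofReal (M.init j) *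
          ∫⁻ y, F (s, o, j, y) ∂(expMeasure M.β) ∂(expMeasure (M.leaveRate i)) := by
  have hp : MeasurePreserving (fun z : Noise n => (z.1 i, z.2.1 i, z.2.2)) M.noiseLaw
      ((expMeasure (M.leaveRate i)).prod ((M.jumpLaw i).prod
        (M.initLaw.prod (expMeasure M.β)))) :=
    (measurePreserving_eval (fun i => expMeasure (M.leaveRate i)) i).prod
      ((measurePreserving_eval (fun i => M.jumpLaw i) i).prod (MeasurePreserving.id _))
  have h1 := hp.lintegral_comp hF
  refine h1.trans ?_
  rw [lintegral_prod _ hF.aemeasurable]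
  refine lintegral_congr fun s => ?_
  rw [lintegral_prod _ (by fun_prop), lintegral_jumpLaw]
  refine Finset.sum_congr rfl fun o _ => ?_
  rw [lintegral_prod _ (by fun_prop), lintegral_initLaw]

theorem measurable_sojournReward' (b : Fin n → ℝ) (i : Fin n) (x : ℝ) :
    Measurable fun s => M.sojournReward b i x s :=
  (M.measurable_sojournReward b i).comp (f := fun s : ℝ => (x, s)) (by fun_prop)

/-- Expected value of `V` right after the jump out of phase `i`, if the surplus is `y` before it. -/
def jumpValue (V : Fin n → ℝ → ℝ≥0∞) (i : Fin n) (y : ℝ) : ℝ≥0∞ :=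
  ∑ j, ENNReal.ofReal (M.jumpProb i (Sum.inl j)) * V j y + ENNReal.ofReal (M.jumpProb i (Sum.inr ()))
    * ∑ j, ENNReal.ofReal (M.init j) * ∫⁻ ξ, V j (y - ξ) ∂(expMeasure M.β)

theorem measurable_jumpValue {V : Fin n → ℝ → ℝ≥0∞} (hV : ∀ j, Measurable (V j)) (i : Fin n) :
    Measurable (M.jumpValue V i) := by
  unfold jumpValue
  refine Measurable.add (by fun_prop) (Measurable.const_mul ?_ _)
  refine Finset.measurable_fun_sum _ fun j _ => Measurable.const_mul ?_ _
  refine Measurable.lintegral_prod_right (f := fun y ξ => V j (y - ξ)) ?_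
  exact (hV j).comp (measurable_fst.sub measurable_snd)

theorem sum_ofReal_init : ∑ j, ENNReal.ofReal (M.init j) = 1 := by
  rw [← ENNReal.ofReal_sum_of_nonneg (fun i _ => M.init_nonneg i), M.init_sum, ENNReal.ofReal_one]

theorem sum_ofReal_jumpProb (i : Fin n) : ∑ o, ENNReal.ofReal (M.jumpProb i o) = 1 := by
  rw [← ENNReal.ofReal_sum_of_nonneg (fun o _ => M.jumpProb_nonneg i o), M.jumpProb_sum,
    ENNReal.ofReal_one]

/-- Only the sojourn length survives as a variable. The restart phase and the claim size, drawn even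
when the jump is not a claim, integrate to total mass one in that case. -/
theorem lintegral_sojourn {V : Fin n → ℝ → ℝ≥0∞} (hV : ∀ j, Measurable (V j)) (b : Fin n → ℝ)
    (i : Fin n) (x : ℝ) :
    ∫⁻ z, (M.sojournReward b i x (sojourn i z) +
      ENNReal.ofReal (Real.exp (-M.δ * sojourn i z)) * V (nextPhase i z)
        (M.surplus b i x (sojourn i z) - claim i z)) ∂M.noiseLaw
      = ∫⁻ s, (M.sojournReward b i x s + ENNReal.ofReal (Real.exp (-M.δ * s)) *
          M.jumpValue V i (M.surplus b i x s)) ∂(expMeasure (M.leaveRate i)) := by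
  have hV' : Measurable fun p : Fin n × ℝ => V p.1 p.2 := measurable_from_prod_countable_right hV
  have hr := M.measurable_sojournReward' b i x
  have hs : Measurable fun s => M.surplus b i x s := by
    unfold surplus
    fun_prop
  have hF : Measurable fun p : ℝ × (Fin n ⊕ Unit) × Fin n × ℝ => M.sojournReward b i x p.1 +
      ENNReal.ofReal (Real.exp (-M.δ * p.1)) * V (Sum.elim (fun j => j) (fun _ => p.2.2.1) p.2.1)
        (M.surplus b i x p.1 - Sum.elim (fun _ => 0) (fun _ => p.2.2.2) p.2.1) := by
    refine Measurable.add (hr.comp measurable_fst) (Measurable.mul (by fun_prop) ?_)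
    refine hV'.comp (f := fun p : ℝ × (Fin n ⊕ Unit) × Fin n × ℝ =>
      (Sum.elim (fun j => j) (fun _ => p.2.2.1) p.2.1,
        M.surplus b i x p.1 - Sum.elim (fun _ => 0) (fun _ => p.2.2.2) p.2.1)) ?_
    have h1 : Measurable fun q : (Fin n ⊕ Unit) × Fin n =>
        Sum.elim (fun j => j) (fun _ => q.2) q.1 :=
      measurable_from_prod_countable_right fun o => by
        rcases o with j | _
        · exact measurable_const
        · exact measurable_id
    have h2 : Measurable fun q : (Fin n ⊕ Unit) × ℝ => Sum.elim (fun _ => 0) (fun _ => q.2) q.1 :=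
      measurable_from_prod_countable_right fun o => by
        rcases o with j | _
        · exact measurable_const
        · exact measurable_id
    refine Measurable.prodMk ?_ (Measurable.sub (hs.comp measurable_fst) ?_)
    · exact h1.comp (f := fun p : ℝ × (Fin n ⊕ Unit) × Fin n × ℝ => (p.2.1, p.2.2.1)) (by fun_prop)
    · exact h2.comp (f := fun p : ℝ × (Fin n ⊕ Unit) × Fin n × ℝ => (p.2.1, p.2.2.2)) (by fun_prop)
  refine (M.lintegral_noiseLaw i hF).trans (lintegral_congr fun s => ?_)
  have hy : ∀ (o : Fin n ⊕ Unit) j, ∫⁻ y, (M.sojournReward b i x s + ENNReal.ofReal (Real.exp (-M.δ * s)) *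
      V (Sum.elim (fun j => j) (fun _ => j) o)
        (M.surplus b i x s - Sum.elim (fun _ => 0) (fun _ => y) o)) ∂(expMeasure M.β)
      = M.sojournReward b i x s + ENNReal.ofReal (Real.exp (-M.δ * s)) *
        ∫⁻ y, V (Sum.elim (fun j => j) (fun _ => j) o)
          (M.surplus b i x s - Sum.elim (fun _ => 0) (fun _ => y) o) ∂(expMeasure M.β) := by
    intro o j
    rw [lintegral_add_left measurable_const, lintegral_const_mul' _ _ ENNReal.ofReal_ne_top]
    simp
  dsimp only
  simp only [hy, mul_add, Finset.sum_add_distrib, ← Finset.sum_mul, M.sum_ofReal_init,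
    M.sum_ofReal_jumpProb, one_mul]
  congr 1
  simp only [mul_left_comm _ (ENNReal.ofReal (Real.exp (-M.δ * s))), ← Finset.mul_sum]
  congr 1
  rw [Fintype.sum_sum_type]
  simp [jumpValue, ← Finset.sum_mul, M.sum_ofReal_init]

theorem sojournReward_le (b : Fin n → ℝ) (hb : ∀ i, 0 ≤ b i) (i : Fin n) {x B : ℝ} (hx : x ≤ B)
    (τ : ℝ) : M.sojournReward b i x τ ≤ ENNReal.ofReal B + ENNReal.ofReal (M.c / M.δ) := by
  rw [sojournReward_eq]
  refine add_le_add (ENNReal.ofReal_le_ofReal (by linarith [hb i])) ?_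
  have h : ∫⁻ u, {u | u ∈ Ioo 0 τ ∧ M.surplus b i x u = b i}.indicator
      (fun u => ENNReal.ofReal (Real.exp (-M.δ * u))) u ≤ ENNReal.ofReal (1 / M.δ) := by
    have := lintegral_exp_neg_mul_Ioi M.δ_pos 0
    rw [mul_zero, Real.exp_zero] at this
    rw [← this, ← lintegral_indicator measurableSet_Ioi]
    refine lintegral_mono fun u => indicator_le_indicator_of_subset ?_ (fun _ => zero_le) u
    intro u hu
    exact hu.1.1
  calc _ ≤ ENNReal.ofReal M.c * ENNReal.ofReal (1 / M.δ) := by gcongr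
    _ = _ := by rw [← ENNReal.ofReal_mul M.c_pos.le, mul_one_div]

/-- The post-jump value is an average over capitals no larger than y, which is why bounds are kept
on half-lines unbounded below. -/
theorem jumpValue_le {V : Fin n → ℝ → ℝ≥0∞} (hV : ∀ j, Measurable (V j)) {K : ℝ≥0∞} {B : ℝ}
    (hK : ∀ j, ∀ x ≤ B, V j x ≤ K) (i : Fin n) {y : ℝ} (hy : y ≤ B) : M.jumpValue V i y ≤ K := by
  have h : ∀ j, ∫⁻ ξ, V j (y - ξ) ∂(expMeasure M.β) ≤ K := by
    intro j
    calc _ ≤ ∫⁻ _, K ∂(expMeasure M.β) := by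
          rw [lintegral_expMeasure (F := fun ξ => V j (y - ξ))
              ((hV j).comp (measurable_const.sub measurable_id)),
            lintegral_expMeasure measurable_const]
          refine setLIntegral_mono' measurableSet_Ioi fun ξ hξ => ?_
          have : 0 < ξ := hξ
          gcongr
          exact hK j _ (by linarith)
      _ = K := by simp
  have h2 : ∑ j, ENNReal.ofReal (M.init j) * ∫⁻ ξ, V j (y - ξ) ∂(expMeasure M.β) ≤ K := by
    calc _ ≤ ∑ j, ENNReal.ofReal (M.init j) * K := by
          gcongr with j
          exact h j
      _ = K := by rw [← Finset.sum_mul, M.sum_ofReal_init, one_mul]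
  calc _ ≤ ∑ j, ENNReal.ofReal (M.jumpProb i (Sum.inl j)) * K
        + ENNReal.ofReal (M.jumpProb i (Sum.inr ())) * K := by
        unfold jumpValue
        gcongr with j
        exact hK j y hy
    _ = (∑ o, ENNReal.ofReal (M.jumpProb i o)) * K := by
        rw [Fintype.sum_sum_type, ← Finset.sum_mul, add_mul]
        simp
    _ = K := by rw [M.sum_ofReal_jumpProb, one_mul]

theorem lintegral_exp_discount (i : Fin n) :
    ∫⁻ s, ENNReal.ofReal (Real.exp (-M.δ * s)) ∂(expMeasure (M.leaveRate i))
      = ENNReal.ofReal (M.leaveRate i / (M.leaveRate i + M.δ)) := by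
  have h := M.leaveRate_pos i
  have hδ := M.δ_pos
  rw [lintegral_expMeasure (by fun_prop)]
  have : ∀ s, ENNReal.ofReal (M.leaveRate i * Real.exp (-(M.leaveRate i * s))) *
      ENNReal.ofReal (Real.exp (-M.δ * s)) = ENNReal.ofReal (M.leaveRate i) *
        ENNReal.ofReal (Real.exp (-(M.leaveRate i + M.δ) * s)) := by
    intro s
    rw [← ENNReal.ofReal_mul (by positivity), ← ENNReal.ofReal_mul h.le, mul_assoc, ← Real.exp_add]
    congr 3
    ring
  simp only [this]
  rw [lintegral_const_mul' _ _ ENNReal.ofReal_ne_top, lintegral_exp_neg_mul_Ioi (by linarith),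
    ← ENNReal.ofReal_mul h.le]
  simp [div_eq_mul_inv]

theorem measurable_eValue' (b : Fin n → ℝ) (i : Fin n) : Measurable (M.eValue b i) :=
  (M.measurable_eValue b).comp measurable_prodMk_left

theorem measurable_partialValue (b : Fin n → ℝ) (m : ℕ) (i : Fin n) :
    Measurable (M.partialValue b m i) := by
  unfold partialValue
  refine Measurable.lintegral_prod_right
    (f := fun (x : ℝ) w => ∑ k ∈ Finset.range m, M.reward b i x w k) ?_
  exact Finset.measurable_fun_sum _ fun k _ =>
    (M.measurable_reward b k).comp (f := fun p : ℝ × (ℕ → Noise n) => ((i, p.1), p.2)) (by fun_prop)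

/-- One sojourn pays at most a constant C and discounts the future by at most Λ / (Λ + δ) < 1, so
induction on the number of sojourns gives a uniform geometric bound. -/
theorem exists_eValue_le (b : Fin n → ℝ) (hb : ∀ i, 0 ≤ b i) (B : ℝ) :
    ∃ K : ℝ≥0∞, K < ∞ ∧ ∀ i, ∀ x ≤ B, M.eValue b i x ≤ K := by
  -- The bound must dominate all barriers, since the surplus within a sojourn can rise to any of
  -- them.
  obtain ⟨B', hB'0, hB'B, hB'b⟩ : ∃ B', 0 ≤ B' ∧ B ≤ B' ∧ ∀ i, b i ≤ B' := by
    refine ⟨|B| + ∑ i, b i, ?_, ?_, fun i => ?_⟩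
    · exact add_nonneg (abs_nonneg _) (Finset.sum_nonneg fun i _ => hb i)
    · linarith [le_abs_self B, Finset.sum_nonneg fun i (_ : i ∈ Finset.univ) => hb i]
    · linarith [abs_nonneg B, Finset.single_le_sum (fun i _ => hb i) (Finset.mem_univ i)]
  have hδ := M.δ_pos
  have hc := M.c_pos
  set Λ : ℝ := ∑ i, M.leaveRate i with hΛ
  have hΛ0 : 0 ≤ Λ := Finset.sum_nonneg fun i _ => (M.leaveRate_pos i).le
  set C : ℝ := B' + M.c / M.δ with hC
  have hC0 : 0 ≤ C := by positivity
  -- K is the fixed point of K ↦ C + Λ / (Λ + δ) K.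
  set K : ℝ := C * (Λ + M.δ) / M.δ with hK
  have hK0 : 0 ≤ K := by positivity
  have hfix : C + Λ / (Λ + M.δ) * K = K := by
    rw [hK]
    field_simp
    ring
  have key : ∀ m, ∀ i, ∀ x ≤ B', M.partialValue b m i x ≤ ENNReal.ofReal K := by
    intro m
    induction m with
    | zero => intro i x _; simp [partialValue]
    | succ m ih =>
      intro i x hx
      rcases lt_or_ge x 0 with h0 | h0
      · simp [partialValue, M.reward_of_neg b i h0]
      rw [M.partialValue_succ b m i h0, M.lintegral_sojourn (M.measurable_partialValue b m)]
      have hi := M.leaveRate_pos i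
      have hiΛ : M.leaveRate i ≤ Λ :=
        Finset.single_le_sum (fun i _ => (M.leaveRate_pos i).le) (Finset.mem_univ i)
      calc _ ≤ ∫⁻ s, (ENNReal.ofReal C + ENNReal.ofReal (Real.exp (-M.δ * s)) *
              ENNReal.ofReal K) ∂(expMeasure (M.leaveRate i)) := by
            refine lintegral_mono fun s => ?_
            refine add_le_add ?_ (mul_le_mul_right ?_ _)
            · rw [hC, ENNReal.ofReal_add hB'0 (by positivity)]
              exact M.sojournReward_le b hb i hx s
            · exact M.jumpValue_le (M.measurable_partialValue b m) ih i
                ((min_le_right _ _).trans (hB'b i))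
        _ = ENNReal.ofReal (C + M.leaveRate i / (M.leaveRate i + M.δ) * K) := by
            rw [lintegral_add_left measurable_const, lintegral_mul_const _ (by fun_prop),
              lintegral_exp_discount, ← ENNReal.ofReal_mul (by positivity), lintegral_const,
              measure_univ, mul_one, ← ENNReal.ofReal_add hC0 (by positivity)]
        _ ≤ ENNReal.ofReal (C + Λ / (Λ + M.δ) * K) := by
            refine ENNReal.ofReal_le_ofReal ?_
            have : M.leaveRate i / (M.leaveRate i + M.δ) ≤ Λ / (Λ + M.δ) := by
              rw [div_le_div_iff₀ (by linarith) (by linarith)]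
              nlinarith
            nlinarith
        _ = _ := by rw [hfix]
  refine ⟨ENNReal.ofReal K, ENNReal.ofReal_lt_top, fun i x hx => ?_⟩
  rw [eValue_eq_iSup]
  exact iSup_le fun m => key m i x (hx.trans hB'B)

theorem eValue_lt_top (b : Fin n → ℝ) (hb : ∀ i, 0 ≤ b i) (i : Fin n) (x : ℝ) :
    M.eValue b i x < ∞ := by
  obtain ⟨K, hK, h⟩ := M.exists_eValue_le b hb x
  exact (h i x le_rfl).trans_lt hK

/-- By Tonelli, a payment at time u is weighted by the probability exp(-λ_i u) that the sojourn
still lasts; discounting turns this into the rate λ_i + δ. -/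
theorem lintegral_sojournReward (b : Fin n → ℝ) (i : Fin n) (x : ℝ) :
    ∫⁻ s, M.sojournReward b i x s ∂(expMeasure (M.leaveRate i))
      = ENNReal.ofReal (x - b i) + ∫⁻ u in Ioi 0,
          ENNReal.ofReal (Real.exp (-(M.leaveRate i + M.δ) * u)) *
          {u | M.surplus b i x u = b i}.indicator (fun _ => ENNReal.ofReal M.c) u := by
  have hA : MeasurableSet {u | M.surplus b i x u = b i} := by
    refine measurableSet_eq_fun ?_ measurable_const
    unfold surplus
    fun_prop
  have hl := M.leaveRate_pos i
  set A := {u | M.surplus b i x u = b i} with hAdef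
  have hset : ∀ τ, {u | u ∈ Ioo 0 τ ∧ M.surplus b i x u = b i} = Ioo 0 τ ∩ A := fun _ => rfl
  have hm : Measurable fun p : ℝ × ℝ => (Ioo 0 p.1 ∩ A).indicator
      (fun u => ENNReal.ofReal (Real.exp (-M.δ * u))) p.2 := by
    have hS : MeasurableSet {p : ℝ × ℝ | (0 < p.2 ∧ p.2 < p.1) ∧ p.2 ∈ A} :=
      ((measurableSet_lt measurable_const measurable_snd).inter
        (measurableSet_lt measurable_snd measurable_fst)).inter (measurable_snd hA)
    exact Measurable.indicator (f := fun p : ℝ × ℝ => ENNReal.ofReal (Real.exp (-M.δ * p.2)))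
      (by fun_prop) hS
  simp only [sojournReward_eq, hset]
  rw [lintegral_add_left measurable_const, lintegral_const, measure_univ, mul_one,
    lintegral_const_mul' _ _ ENNReal.ofReal_ne_top, lintegral_lintegral_swap hm.aemeasurable,
    ← lintegral_const_mul' _ _ ENNReal.ofReal_ne_top, ← lintegral_indicator measurableSet_Ioi]
  congr 1
  refine lintegral_congr fun u => ?_
  by_cases hu : 0 < u ∧ u ∈ A
  · have h1 : ∀ s, (Ioo 0 s ∩ A).indicator (fun u => ENNReal.ofReal (Real.exp (-M.δ * u))) u
        = (Ioi u).indicator (fun _ => ENNReal.ofReal (Real.exp (-M.δ * u))) s := by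
      intro s
      by_cases hs : u < s
      · rw [indicator_of_mem (show u ∈ Ioo 0 s ∩ A from ⟨⟨hu.1, hs⟩, hu.2⟩),
          indicator_of_mem (show s ∈ Ioi u from hs)]
      · rw [indicator_of_notMem (fun h => hs h.1.2),
          indicator_of_notMem (show s ∉ Ioi u from hs)]
    have h2 : expMeasure (M.leaveRate i) (Ioi u)
        = ENNReal.ofReal (Real.exp (-M.leaveRate i * u)) := by
      rw [← lintegral_indicator_one measurableSet_Ioi,
        lintegral_expMeasure (measurable_one.indicator measurableSet_Ioi)]
      have h3 : ∀ s, ENNReal.ofReal (M.leaveRate i * Real.exp (-(M.leaveRate i * s))) *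
          (Ioi u).indicator 1 s = (Ioi u).indicator (fun s => ENNReal.ofReal (M.leaveRate i) *
            ENNReal.ofReal (Real.exp (-M.leaveRate i * s))) s := by
        intro s
        by_cases hs : s ∈ Ioi u
        · simp [indicator_of_mem hs, ENNReal.ofReal_mul hl.le]
        · simp [indicator_of_notMem hs]
      simp only [h3]
      rw [setLIntegral_indicator measurableSet_Ioi, inter_eq_left.2 (Ioi_subset_Ioi hu.1.le),
        lintegral_const_mul' _ _ ENNReal.ofReal_ne_top, lintegral_exp_neg_mul_Ioi hl,
        ← ENNReal.ofReal_mul hl.le]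
      congr 1
      field_simp
    simp only [h1]
    rw [lintegral_indicator_const measurableSet_Ioi, h2, indicator_of_mem (show u ∈ Ioi 0 from hu.1),
      indicator_of_mem hu.2, ← ENNReal.ofReal_mul (Real.exp_pos _).le, mul_comm, ← Real.exp_add]
    congr 3
    ring
  · have h1 : ∀ s, (Ioo 0 s ∩ A).indicator (fun u => ENNReal.ofReal (Real.exp (-M.δ * u))) u = 0 :=
      fun s => indicator_of_notMem (fun h => hu ⟨h.1.1, h.2⟩) _
    simp only [h1, lintegral_zero, mul_zero]
    by_cases h0 : u ∈ Ioi 0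
    · rw [indicator_of_mem h0, indicator_of_notMem (fun h => hu ⟨h0, h⟩), mul_zero]
    · rw [indicator_of_notMem h0]

theorem eValue_eq_lintegral (b : Fin n → ℝ) (i : Fin n) {x : ℝ} (hx : 0 ≤ x) :
    M.eValue b i x = ENNReal.ofReal (x - b i) + ∫⁻ u in Ioi 0,
      ENNReal.ofReal (Real.exp (-(M.leaveRate i + M.δ) * u)) *
        ({u | M.surplus b i x u = b i}.indicator (fun _ => ENNReal.ofReal M.c) u +
          ENNReal.ofReal (M.leaveRate i) *
            M.jumpValue (M.eValue b) i (M.surplus b i x u)) := by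
  have hl := M.leaveRate_pos i
  have hs : Measurable fun s => M.surplus b i x s := by
    unfold surplus
    fun_prop
  have hr := M.measurable_sojournReward' b i x
  have hA : MeasurableSet {u | M.surplus b i x u = b i} := measurableSet_eq_fun hs measurable_const
  have hj : Measurable fun s => M.jumpValue (M.eValue b) i (M.surplus b i x s) :=
    (M.measurable_jumpValue (M.measurable_eValue' b) i).comp hs
  rw [M.eValue_renewal b i hx, M.lintegral_sojourn (M.measurable_eValue' b),
    lintegral_add_left hr, lintegral_sojournReward, add_assoc, lintegral_expMeasure (by fun_prop)]
  simp only [mul_add]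
  rw [lintegral_add_left (f := fun u => ENNReal.ofReal (Real.exp (-(M.leaveRate i + M.δ) * u)) *
    {u | M.surplus b i x u = b i}.indicator (fun _ => ENNReal.ofReal M.c) u)
    (Measurable.mul (by fun_prop) (measurable_const.indicator hA))]
  congr 2
  refine lintegral_congr fun u => ?_
  rw [← mul_assoc, ← mul_assoc, ← ENNReal.ofReal_mul (by positivity),
    ← ENNReal.ofReal_mul (Real.exp_pos _).le]
  congr 2
  rw [mul_assoc, ← Real.exp_add, mul_comm]
  congr 2
  ring

end PhaseModel

/-! ### Regularity of the value functions and their integro-differential equation. -/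

theorem hasDerivWithinAt_integral_Ici {φ : ℝ → ℝ} (hφ : ContinuousOn φ (Ici 0)) {x : ℝ}
    (hx : 0 ≤ x) : HasDerivWithinAt (fun x => ∫ y in (0 : ℝ)..x, φ y) (φ x) (Ici 0) x := by
  -- Extending φ by its value at 0 reduces the one-sided derivative at 0 to the two-sided
  -- fundamental theorem.
  have hc : Continuous fun y => φ (max y 0) :=
    hφ.comp_continuous (by fun_prop) fun y => le_max_right y 0
  have h := (hc.integral_hasStrictDerivAt 0 x).hasDerivAt.hasDerivWithinAt (s := Ici 0)
  rw [max_eq_left hx] at h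
  refine h.congr_of_mem (fun z hz => ?_) hx
  refine intervalIntegral.integral_congr fun y hy => ?_
  rw [uIcc_of_le hz] at hy
  simp only [max_eq_left hy.1]

namespace PhaseModel

variable {n : ℕ} (M : PhaseModel n)

/-- Derivative of the claim term of functions that are continuous on `[0, ∞)`. -/
theorem hasDerivWithinAt_claimTerm {f : Fin n → ℝ → ℝ} (hf : ∀ i, ContinuousOn (f i) (Ici 0))
    {x : ℝ} (hx : 0 ≤ x) : HasDerivWithinAt (M.claimTerm f)
      (M.β * (∑ i, M.init i * f i x - M.claimTerm f x)) (Ici 0) x := by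
  have hφ : ContinuousOn (fun y => Real.exp (M.β * y) * ∑ i, M.init i * f i y) (Ici 0) := by
    fun_prop
  have h1 := hasDerivWithinAt_integral_Ici hφ hx
  have h2 : HasDerivAt (fun y => M.β * Real.exp (-M.β * y))
      (M.β * (Real.exp (-M.β * x) * (-M.β * 1))) x :=
    (((hasDerivAt_id x).const_mul (-M.β)).exp).const_mul M.β
  have h3 := h2.hasDerivWithinAt.mul h1
  refine h3.congr_deriv ?_
  have he : Real.exp (-M.β * x) * Real.exp (M.β * x) = 1 := by
    rw [← Real.exp_add]
    simp
  unfold claimTerm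
  linear_combination (M.β * ∑ i, M.init i * f i x) * he

/-- Rate at which value is collected by the jumps out of phase `i`, at surplus `y`. -/
def jumpRate (b : Fin n → ℝ) (i : Fin n) (y : ℝ) : ℝ :=
  M.leaveRate i * (M.jumpValue (M.eValue b) i y).toReal

theorem measurable_jumpRate (b : Fin n → ℝ) (i : Fin n) : Measurable (M.jumpRate b i) :=
  (M.measurable_jumpValue (M.measurable_eValue' b) i).ennreal_toReal.const_mul _

theorem measurable_value (b : Fin n → ℝ) (i : Fin n) : Measurable (M.value b i) := by
  have : M.value b i = fun x => (M.eValue b i x).toReal := funext (M.value_eq b i)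
  rw [this]
  exact (M.measurable_eValue' b i).ennreal_toReal

theorem jumpRate_nonneg (b : Fin n → ℝ) (i : Fin n) (y : ℝ) : 0 ≤ M.jumpRate b i y :=
  mul_nonneg (M.leaveRate_pos i).le ENNReal.toReal_nonneg

theorem value_nonneg (b : Fin n → ℝ) (i : Fin n) (y : ℝ) : 0 ≤ M.value b i y :=
  ENNReal.toReal_nonneg

theorem jumpValue_lt_top (b : Fin n → ℝ) (hb : ∀ i, 0 ≤ b i) (i : Fin n) (y : ℝ) :
    M.jumpValue (M.eValue b) i y < ∞ := by
  obtain ⟨K, hK, h⟩ := M.exists_eValue_le b hb y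
  exact (M.jumpValue_le (M.measurable_eValue' b) h i le_rfl).trans_lt hK

theorem exists_value_le (b : Fin n → ℝ) (hb : ∀ i, 0 ≤ b i) (B : ℝ) :
    ∃ K : ℝ, ∀ i, ∀ x ≤ B, M.value b i x ≤ K ∧ M.jumpRate b i x ≤ M.leaveRate i * K := by
  obtain ⟨K, hK, h⟩ := M.exists_eValue_le b hb B
  refine ⟨K.toReal, fun i x hx => ⟨?_, ?_⟩⟩
  · rw [value_eq]
    exact ENNReal.toReal_mono hK.ne (h i x hx)
  · exact mul_le_mul_of_nonneg_left (ENNReal.toReal_mono hK.ne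
      (M.jumpValue_le (M.measurable_eValue' b) h i hx)) (M.leaveRate_pos i).le

theorem integrableOn_value (b : Fin n → ℝ) (hb : ∀ i, 0 ≤ b i) (i : Fin n) (a x : ℝ) :
    IntegrableOn (M.value b i) (Icc a x) := by
  obtain ⟨K, h⟩ := M.exists_value_le b hb x
  refine Measure.integrableOn_of_bounded (M := K) (by simp)
    (M.measurable_value b i).aestronglyMeasurable ?_
  refine (ae_restrict_iff' measurableSet_Icc).2 (Filter.Eventually.of_forall fun y hy => ?_)
  rw [Real.norm_eq_abs, abs_of_nonneg (M.value_nonneg b i y)]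
  exact (h i y hy.2).1

theorem integrableOn_jumpRate (b : Fin n → ℝ) (hb : ∀ i, 0 ≤ b i) (i : Fin n) (a x : ℝ) :
    IntegrableOn (M.jumpRate b i) (Icc a x) := by
  obtain ⟨K, h⟩ := M.exists_value_le b hb x
  refine Measure.integrableOn_of_bounded (M := M.leaveRate i * K) (by simp)
    (M.measurable_jumpRate b i).aestronglyMeasurable ?_
  refine (ae_restrict_iff' measurableSet_Icc).2 (Filter.Eventually.of_forall fun y hy => ?_)
  rw [Real.norm_eq_abs, abs_of_nonneg (M.jumpRate_nonneg b i y)]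
  exact (h i y hy.2).2

theorem eValue_above (b : Fin n → ℝ) (i : Fin n) {x : ℝ} (hx : 0 ≤ x) (hbx : b i ≤ x) :
    M.eValue b i x = ENNReal.ofReal (x - b i) + ENNReal.ofReal (1 / (M.leaveRate i + M.δ)) *
      (ENNReal.ofReal M.c + ENNReal.ofReal (M.leaveRate i) *
        M.jumpValue (M.eValue b) i (b i)) := by
  have hk : 0 < M.leaveRate i + M.δ := add_pos (M.leaveRate_pos i) M.δ_pos
  rw [M.eValue_eq_lintegral b i hx]
  congr 1
  have h1 := lintegral_exp_neg_mul_Ioi hk 0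
  rw [mul_zero, Real.exp_zero] at h1
  rw [← h1, ← lintegral_mul_const _ (by fun_prop)]
  refine setLIntegral_congr_fun measurableSet_Ioi fun u hu => ?_
  have hs : M.surplus b i x u = b i := by
    refine min_eq_right ?_
    have := mul_pos M.c_pos (show 0 < u from hu)
    linarith
  simp only [hs]
  rw [indicator_of_mem (show u ∈ {u | M.surplus b i x u = b i} from hs)]

theorem value_barrier (b : Fin n → ℝ) (hb : ∀ i, 0 ≤ b i) (i : Fin n) :
    (M.leaveRate i + M.δ) * M.value b i (b i) = M.c + M.jumpRate b i (b i) := by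
  have hk : 0 < M.leaveRate i + M.δ := add_pos (M.leaveRate_pos i) M.δ_pos
  rw [value_eq, M.eValue_above b i (hb i) le_rfl, sub_self, ENNReal.ofReal_zero, zero_add,
    ENNReal.toReal_mul, ENNReal.toReal_add ENNReal.ofReal_ne_top (ENNReal.mul_ne_top
      ENNReal.ofReal_ne_top (M.jumpValue_lt_top b hb i _).ne), ENNReal.toReal_mul,
    ENNReal.toReal_ofReal (by positivity), ENNReal.toReal_ofReal M.c_pos.le,
    ENNReal.toReal_ofReal (M.leaveRate_pos i).le, jumpRate]
  field_simp

theorem value_above (b : Fin n → ℝ) (hb : ∀ i, 0 ≤ b i) (i : Fin n) {x : ℝ} (hx : b i ≤ x) :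
    M.value b i x = x - b i + M.value b i (b i) := by
  have h : M.eValue b i x = ENNReal.ofReal (x - b i) + M.eValue b i (b i) := by
    rw [M.eValue_above b i ((hb i).trans hx) hx, M.eValue_above b i (hb i) le_rfl]
    simp
  rw [value_eq, value_eq, h, ENNReal.toReal_add ENNReal.ofReal_ne_top
    (M.eValue_lt_top b hb i _).ne, ENNReal.toReal_ofReal (by linarith)]

/-- The time integral is split at the time (b_i - x) / c at which the barrier is reached; from then
on the surplus stays there until the jump, and the tail is the value at the barrier with its weight.
-/
theorem value_below (b : Fin n → ℝ) (hb : ∀ i, 0 ≤ b i) (i : Fin n) {x : ℝ} (hx : 0 ≤ x)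
    (hxb : x ≤ b i) :
    M.value b i x = (∫ u in (0 : ℝ)..(b i - x) / M.c,
        Real.exp (-(M.leaveRate i + M.δ) * u) * M.jumpRate b i (x + M.c * u)) +
      Real.exp (-(M.leaveRate i + M.δ) * ((b i - x) / M.c)) * M.value b i (b i) := by
  have hl := M.leaveRate_pos i
  have hc := M.c_pos
  have hk : 0 < M.leaveRate i + M.δ := add_pos hl M.δ_pos
  set k := M.leaveRate i + M.δ with hkdef
  set t := (b i - x) / M.c with ht
  have ht0 : 0 ≤ t := div_nonneg (by linarith) hc.le
  have hct : M.c * t = b i - x := by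
    rw [ht]
    field_simp
  set P : ℝ → ℝ≥0∞ := fun u => ENNReal.ofReal (Real.exp (-k * u)) *
    (ENNReal.ofReal (M.leaveRate i) * M.jumpValue (M.eValue b) i (x + M.c * u)) with hP
  have hPm : Measurable P := by
    have := M.measurable_jumpValue (M.measurable_eValue' b) i
    fun_prop
  have hPtop : ∀ u, P u < ∞ := fun u => ENNReal.mul_lt_top ENNReal.ofReal_lt_top
    (ENNReal.mul_lt_top ENNReal.ofReal_lt_top (M.jumpValue_lt_top b hb i _))
  have hPr : ∀ u, (P u).toReal = Real.exp (-k * u) * M.jumpRate b i (x + M.c * u) := by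
    intro u
    simp only [hP, jumpRate, ENNReal.toReal_mul, ENNReal.toReal_ofReal (Real.exp_pos _).le,
      ENNReal.toReal_ofReal hl.le]
  have h : M.eValue b i x = (∫⁻ u in Ioo 0 t, P u) +
      ENNReal.ofReal (Real.exp (-k * t)) * M.eValue b i (b i) := by
    rw [M.eValue_eq_lintegral b i hx, ENNReal.ofReal_of_nonpos (by linarith), zero_add,
      ← Ioc_union_Ioi_eq_Ioi ht0, lintegral_union measurableSet_Ioi
        (disjoint_left.2 fun u h1 h2 => not_lt.2 h1.2 h2), restrict_Ioo_eq_restrict_Ioc.symm]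
    congr 1
    · refine setLIntegral_congr_fun measurableSet_Ioo fun u hu => ?_
      have hlt : x + M.c * u < b i := by nlinarith [hu.2]
      have hs : M.surplus b i x u = x + M.c * u := min_eq_left hlt.le
      simp only [hs, hP, ← hkdef]
      rw [indicator_of_notMem, zero_add]
      intro h
      have h' : M.surplus b i x u = b i := h
      rw [hs] at h'
      exact hlt.ne h'
    · rw [M.eValue_above b i (hb i) le_rfl, sub_self, ENNReal.ofReal_zero, zero_add, ← mul_assoc,
        ← ENNReal.ofReal_mul (Real.exp_pos _).le, mul_one_div, ← lintegral_exp_neg_mul_Ioi hk,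
        ← lintegral_mul_const _ (by fun_prop)]
      refine setLIntegral_congr_fun measurableSet_Ioi fun u hu => ?_
      have hs : M.surplus b i x u = b i := by
        refine min_eq_right ?_
        have : t < u := hu
        nlinarith
      simp only [hs]
      rw [indicator_of_mem (show u ∈ {u | M.surplus b i x u = b i} from hs)]
  have hint : (∫⁻ u in Ioo 0 t, P u).toReal
      = ∫ u in (0 : ℝ)..t, Real.exp (-k * u) * M.jumpRate b i (x + M.c * u) := by
    rw [← integral_toReal hPm.aemeasurable (Filter.Eventually.of_forall hPtop),
      intervalIntegral.integral_of_le ht0, restrict_Ioo_eq_restrict_Ioc]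
    simp only [hPr]
  have hfin : (∫⁻ u in Ioo 0 t, P u) ≠ ∞ := by
    refine ((le_self_add.trans_eq h.symm).trans_lt (M.eValue_lt_top b hb i x)).ne
  rw [value_eq, h, ENNReal.toReal_add hfin (ENNReal.mul_ne_top ENNReal.ofReal_ne_top
    (M.eValue_lt_top b hb i _).ne), hint, ENNReal.toReal_mul,
    ENNReal.toReal_ofReal (Real.exp_pos _).le, value_eq]

/-- Substituting the capital y = x + c u moves x out of the integrand into a prefactor and an
endpoint, where regularity in x can be read off. -/
theorem exp_mul_value (b : Fin n → ℝ) (hb : ∀ i, 0 ≤ b i) (i : Fin n) {x : ℝ} (hx : 0 ≤ x)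
    (hxb : x ≤ b i) :
    M.value b i x = Real.exp ((M.leaveRate i + M.δ) / M.c * x) * (M.c⁻¹ * (∫ y in x..b i,
      Real.exp (-((M.leaveRate i + M.δ) / M.c) * y) * M.jumpRate b i y) +
      Real.exp (-((M.leaveRate i + M.δ) / M.c) * b i) * M.value b i (b i)) := by
  have hc := M.c_pos
  set k := M.leaveRate i + M.δ with hk
  have h1 : (∫ u in (0 : ℝ)..(b i - x) / M.c, Real.exp (-k * u) * M.jumpRate b i (x + M.c * u))
      = M.c⁻¹ * ∫ y in x..b i, Real.exp (k / M.c * x) *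
        (Real.exp (-(k / M.c) * y) * M.jumpRate b i y) := by
    have h2 := intervalIntegral.integral_comp_add_mul (a := 0) (b := (b i - x) / M.c)
      (fun y => Real.exp (k / M.c * x) * (Real.exp (-(k / M.c) * y) * M.jumpRate b i y)) hc.ne' x
    have h3 : x + M.c * ((b i - x) / M.c) = b i := by
      field_simp
      ring
    rw [h3, mul_zero, add_zero, smul_eq_mul] at h2
    rw [← h2]
    refine intervalIntegral.integral_congr fun u _ => ?_
    rw [← mul_assoc, ← Real.exp_add]
    congr 2
    field_simp
    ring
  rw [M.value_below b hb i hx hxb, h1, intervalIntegral.integral_const_mul, mul_add, ← mul_assoc,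
    ← mul_assoc, ← mul_assoc, ← Real.exp_add, mul_comm M.c⁻¹]
  congr 3
  field_simp
  ring

/-- First step of a bootstrap: integrability of `jumpRate` already gives continuity of the value,
which makes `jumpRate` continuous and hence the value differentiable. -/
theorem continuousOn_value (b : Fin n → ℝ) (hb : ∀ i, 0 ≤ b i) (i : Fin n) :
    ContinuousOn (M.value b i) (Ici 0) := by
  have h1 : ContinuousOn (M.value b i) (Icc 0 (b i)) := by
    have hφ : IntegrableOn (fun y => Real.exp (-((M.leaveRate i + M.δ) / M.c) * y) *
        M.jumpRate b i y) (uIcc 0 (b i)) := by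
      rw [uIcc_of_le (hb i)]
      exact (M.integrableOn_jumpRate b hb i 0 (b i)).continuousOn_mul (by fun_prop) isCompact_Icc
    have := intervalIntegral.continuousOn_primitive_interval_left hφ
    rw [uIcc_of_le (hb i)] at this
    refine ContinuousOn.congr ?_ fun x hx => M.exp_mul_value b hb i hx.1 hx.2
    fun_prop
  have h2 : ContinuousOn (M.value b i) (Ici (b i)) := by
    refine ContinuousOn.congr (f := fun x => x - b i + M.value b i (b i)) (by fun_prop) ?_
    exact fun x hx => M.value_above b hb i hx
  rw [← Icc_union_Ici_eq_Ici (hb i)]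
  exact h1.union_of_isClosed h2 isClosed_Icc isClosed_Ici

/-- Claims larger than y ruin and contribute nothing, so the integral stops at y; then u = y - ξ. -/
theorem toReal_lintegral_claim (b : Fin n → ℝ) (hb : ∀ i, 0 ≤ b i) (j : Fin n) {y : ℝ}
    (hy : 0 ≤ y) : (∫⁻ ξ, M.eValue b j (y - ξ) ∂(expMeasure M.β)).toReal
      = M.β * Real.exp (-M.β * y) * ∫ u in (0 : ℝ)..y, Real.exp (M.β * u) * M.value b j u := by
  have hβ := M.β_pos
  have hm : Measurable fun ξ => M.eValue b j (y - ξ) :=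
    (M.measurable_eValue' b j).comp (measurable_const.sub measurable_id)
  rw [lintegral_expMeasure hm, ← integral_toReal
    (f := fun s => ENNReal.ofReal (M.β * Real.exp (-(M.β * s))) * M.eValue b j (y - s))
    (Measurable.mul (by fun_prop) hm).aemeasurable (Filter.Eventually.of_forall fun ξ =>
      ENNReal.mul_lt_top ENNReal.ofReal_lt_top (M.eValue_lt_top b hb j _))]
  rw [setIntegral_eq_of_subset_of_forall_sdiff_eq_zero measurableSet_Ioi
    (show Ioc 0 y ⊆ Ioi 0 from Ioc_subset_Ioi_self), ← intervalIntegral.integral_of_le hy]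
  · have h2 := intervalIntegral.integral_comp_sub_left (a := 0) (b := y)
      (fun u => M.β * Real.exp (-M.β * y) * (Real.exp (M.β * u) * M.value b j u)) y
    rw [sub_self, sub_zero] at h2
    rw [← intervalIntegral.integral_const_mul, ← h2]
    refine intervalIntegral.integral_congr fun ξ _ => ?_
    simp only [ENNReal.toReal_mul, ← value_eq]
    rw [ENNReal.toReal_ofReal (by positivity), ← mul_assoc, mul_assoc M.β (Real.exp (-M.β * y)),
      ← Real.exp_add]
    congr 3
    ring
  · intro ξ hξ
    have h0 : y < ξ := by
      by_contra h
      exact hξ.2 ⟨hξ.1, not_lt.1 h⟩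
    rw [M.eValue_of_neg b j (by linarith), mul_zero, ENNReal.toReal_zero]

theorem jumpRate_eq (b : Fin n → ℝ) (hb : ∀ i, 0 ≤ b i) (i : Fin n) {y : ℝ} (hy : 0 ≤ y) :
    M.jumpRate b i y = (∑ j ∈ Finset.univ.erase i, M.T i j * M.value b j y)
      + M.claimRate i * M.claimTerm (M.value b) y := by
  have hl := M.leaveRate_pos i
  have hfin : ∀ j, (∫⁻ ξ, M.eValue b j (y - ξ) ∂(expMeasure M.β)) ≠ ∞ := by
    intro j
    obtain ⟨K, hK, h⟩ := M.exists_eValue_le b hb y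
    refine (lt_of_le_of_lt ?_ hK).ne
    have hm : Measurable fun ξ => M.eValue b j (y - ξ) :=
      (M.measurable_eValue' b j).comp (measurable_const.sub measurable_id)
    calc _ ≤ ∫⁻ _, K ∂(expMeasure M.β) := by
          rw [lintegral_expMeasure hm, lintegral_expMeasure measurable_const]
          refine setLIntegral_mono' measurableSet_Ioi fun ξ hξ => ?_
          have : 0 < ξ := hξ
          gcongr
          exact h j _ (by linarith)
      _ = K := by simp
  have hclaim : M.claimTerm (M.value b) y = ∑ j, M.init j *
      (∫⁻ ξ, M.eValue b j (y - ξ) ∂(expMeasure M.β)).toReal := by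
    simp only [M.toReal_lintegral_claim b hb _ hy, claimTerm, Finset.mul_sum]
    rw [intervalIntegral.integral_finsetSum]
    · rw [Finset.mul_sum]
      refine Finset.sum_congr rfl fun j _ => ?_
      simp only [mul_left_comm _ (M.init j)]
      rw [intervalIntegral.integral_const_mul]
      ring
    · intro j _
      refine (intervalIntegrable_iff_integrableOn_Icc_of_le hy).2 ?_
      refine IntegrableOn.continuousOn_mul (by fun_prop) ?_ isCompact_Icc
      exact (M.integrableOn_value b hb j 0 y).const_mul _
  have h1 : ∀ j, ENNReal.ofReal (M.jumpProb i (Sum.inl j)) * M.eValue b j y ≠ ∞ := fun j =>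
    ENNReal.mul_ne_top ENNReal.ofReal_ne_top (M.eValue_lt_top b hb j y).ne
  have h2 : ∀ j, ENNReal.ofReal (M.init j) *
      ∫⁻ ξ, M.eValue b j (y - ξ) ∂(expMeasure M.β) ≠ ∞ := fun j =>
    ENNReal.mul_ne_top ENNReal.ofReal_ne_top (hfin j)
  rw [jumpRate, jumpValue, ENNReal.toReal_add (ENNReal.sum_ne_top.2 fun j _ => h1 j)
    (ENNReal.mul_ne_top ENNReal.ofReal_ne_top (ENNReal.sum_ne_top.2 fun j _ => h2 j)),
    ENNReal.toReal_sum fun j _ => h1 j, ENNReal.toReal_mul, ENNReal.toReal_sum fun j _ => h2 j,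
    hclaim]
  simp only [ENNReal.toReal_mul, ENNReal.toReal_ofReal (M.jumpProb_nonneg i _),
    ENNReal.toReal_ofReal (M.init_nonneg _), ← value_eq]
  rw [mul_add, ← mul_assoc]
  congr 1
  · rw [Finset.mul_sum, ← Finset.add_sum_erase _ _ (Finset.mem_univ i)]
    simp only [jumpProb, if_true, zero_mul, mul_zero, zero_add]
    refine Finset.sum_congr rfl fun j hj => ?_
    rw [if_neg (Finset.ne_of_mem_erase hj)]
    field_simp
  · congr 1
    simp only [jumpProb]
    field_simp

/-- The value functions are differentiable, have slope one above the barrier, and solve the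
integro-differential equation of the phase below it. -/
theorem exists_deriv_value (b : Fin n → ℝ) (hb : ∀ i, 0 ≤ b i) : ∃ D : Fin n → ℝ → ℝ,
    (∀ i x, 0 ≤ x → HasDerivWithinAt (M.value b i) (D i x) (Ici 0) x) ∧
    (∀ i x, b i ≤ x → D i x = 1) ∧
    (∀ i x, 0 ≤ x → x ≤ b i → M.c * D i x +
      (∑ j ∈ Finset.univ.erase i, M.T i j * M.value b j x)
        + M.claimRate i * M.claimTerm (M.value b) x
        - (M.leaveRate i + M.δ) * M.value b i x = 0) := by
  have hc := M.c_pos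
  have hJc : ∀ i, ContinuousOn (M.jumpRate b i) (Ici 0) := by
    intro i
    have h3 : ContinuousOn (M.claimTerm (M.value b)) (Ici 0) := fun x hx =>
      (M.hasDerivWithinAt_claimTerm (M.continuousOn_value b hb) hx).continuousWithinAt
    have h4 := M.continuousOn_value b hb
    refine ContinuousOn.congr ?_ fun x hx => M.jumpRate_eq b hb i hx
    fun_prop
  have habove : ∀ i x, b i ≤ x → HasDerivWithinAt (M.value b i) 1 (Ici (b i)) x := by
    intro i x hx
    have h : HasDerivWithinAt (fun x => x - b i + M.value b i (b i)) 1 (Ici (b i)) x :=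
      (((hasDerivAt_id x).sub_const _).add_const _).hasDerivWithinAt
    exact h.congr_of_mem (fun z hz => M.value_above b hb i hz) hx
  have hbelow : ∀ i x, 0 ≤ x → x ≤ b i → HasDerivWithinAt (M.value b i)
      (((M.leaveRate i + M.δ) * M.value b i x - M.jumpRate b i x) / M.c) (Icc 0 (b i)) x := by
    intro i x hx hxb
    set κ := (M.leaveRate i + M.δ) / M.c with hκ
    have hφ : ContinuousOn (fun y => Real.exp (-κ * y) * M.jumpRate b i y) (Ici 0) := by
      have := hJc i
      fun_prop
    have hint : ∀ z, 0 ≤ z → IntervalIntegrable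
        (fun y => Real.exp (-κ * y) * M.jumpRate b i y) volume 0 z := fun z hz =>
      (hφ.mono (by rw [uIcc_of_le hz]; exact Icc_subset_Ici_self)).intervalIntegrable
    have h1 := hasDerivWithinAt_integral_Ici hφ hx
    have h2 : HasDerivAt (fun y => Real.exp (κ * y)) (Real.exp (κ * x) * (κ * 1)) x :=
      ((hasDerivAt_id x).const_mul κ).exp
    have h3 := (h2.hasDerivWithinAt (s := Ici 0)).mul
      (((h1.const_sub (∫ y in (0 : ℝ)..b i, Real.exp (-κ * y) * M.jumpRate b i y)).const_mul
        M.c⁻¹).add_const (Real.exp (-κ * b i) * M.value b i (b i)))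
    have h4 := h3.mono (s := Icc 0 (b i)) Icc_subset_Ici_self
    have hval : ∀ z ∈ Icc 0 (b i), M.value b i z = Real.exp (κ * z) * (M.c⁻¹ *
        ((∫ y in (0 : ℝ)..b i, Real.exp (-κ * y) * M.jumpRate b i y) -
          ∫ y in (0 : ℝ)..z, Real.exp (-κ * y) * M.jumpRate b i y) +
          Real.exp (-κ * b i) * M.value b i (b i)) := by
      intro z hz
      rw [M.exp_mul_value b hb i hz.1 hz.2,
        intervalIntegral.integral_interval_sub_left (hint _ (hb i)) (hint _ hz.1)]
    refine (h4.congr_of_mem hval ⟨hx, hxb⟩).congr_deriv ?_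
    have he : Real.exp (κ * x) * Real.exp (-κ * x) = 1 := by
      rw [← Real.exp_add]
      simp
    have hx' := hval x ⟨hx, hxb⟩
    have hcc : M.c⁻¹ * M.c = 1 := inv_mul_cancel₀ hc.ne'
    rw [sub_div, mul_div_right_comm, ← hκ, hx', div_eq_mul_inv]
    linear_combination (-M.jumpRate b i x * M.c⁻¹) * he
  -- Smooth fit: paying out at rate c at the barrier forces the left slope given by the equation to
  -- be 1 as well.
  have hbar : ∀ i, ((M.leaveRate i + M.δ) * M.value b i (b i) - M.jumpRate b i (b i)) / M.c = 1 := by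
    intro i
    rw [M.value_barrier b hb i]
    field_simp
    ring
  classical
  refine ⟨fun i x => if b i ≤ x then 1 else
    ((M.leaveRate i + M.δ) * M.value b i x - M.jumpRate b i x) / M.c, ?_, ?_, ?_⟩
  · intro i x hx
    beta_reduce
    rcases lt_trichotomy x (b i) with h | h | h
    · rw [if_neg (not_le.2 h)]
      refine (hbelow i x hx h.le).mono_of_mem_nhdsWithin ?_
      rw [← Ici_inter_Iic]
      exact Filter.inter_mem self_mem_nhdsWithin (mem_nhdsWithin_of_mem_nhds (Iic_mem_nhds h))
    · subst h
      rw [if_pos le_rfl, ← Icc_union_Ici_eq_Ici (hb i)]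
      refine HasDerivWithinAt.union ?_ (habove i _ le_rfl)
      exact (hbelow i _ hx le_rfl).congr_deriv (hbar i)
    · rw [if_pos h.le]
      exact ((habove i x h.le).hasDerivAt (Ici_mem_nhds h)).hasDerivWithinAt
  · intro i x hx
    exact if_pos hx
  · intro i x hx hxb
    have hD : (if b i ≤ x then 1 else
        ((M.leaveRate i + M.δ) * M.value b i x - M.jumpRate b i x) / M.c)
        = ((M.leaveRate i + M.δ) * M.value b i x - M.jumpRate b i x) / M.c := by
      split_ifs with h
      · rw [le_antisymm hxb h, hbar]
      · rfl
    simp only [hD]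
    rw [mul_div_cancel₀ _ hc.ne', M.jumpRate_eq b hb i hx]
    ring

end PhaseModel

/-! ### One-sided calculus and the minimum principle. -/

theorem eventually_lt_of_hasDerivWithinAt_pos {f : ℝ → ℝ} {d x : ℝ}
    (h : HasDerivWithinAt f d (Ici x) x) (hd : 0 < d) :
    ∃ ε > 0, ∀ y ∈ Ioc x (x + ε), f x < f y := by
  have h1 := (hasDerivWithinAt_iff_tendsto_slope' (notMem_Ioi.2 le_rfl)).1 h.Ioi_of_Ici
  have h2 := h1.eventually (lt_mem_nhds hd)
  obtain ⟨u, hu, hsub⟩ := (mem_nhdsGT_iff_exists_Ioc_subset).1 h2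
  refine ⟨u - x, sub_pos.2 hu, fun y hy => ?_⟩
  have h3 : 0 < slope f x y := hsub ⟨hy.1, by linarith [hy.2]⟩
  rw [slope_def_field] at h3
  have := (div_pos_iff_of_pos_right (sub_pos.2 hy.1)).1 h3
  linarith

theorem antitoneOn_of_hasDerivWithinAt_Ici {f f' : ℝ → ℝ} {s a b : ℝ}
    (hf : ∀ x ∈ Icc a b, HasDerivWithinAt f (f' x) (Ici s) x) (hs : s ≤ a)
    (hf' : ∀ x ∈ Icc a b, f' x ≤ 0) : AntitoneOn f (Icc a b) := by
  have hsub : Icc a b ⊆ Ici s := fun y hy => hs.trans hy.1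
  refine antitoneOn_of_hasDerivWithinAt_nonpos (convex_Icc a b) (f' := f')
    (fun x hx => ((hf x hx).mono hsub).continuousWithinAt) (fun x hx => ?_)
    (fun x hx => hf' x (interior_subset hx))
  exact (hf x (interior_subset hx)).mono (interior_subset.trans hsub)

theorem monotoneOn_of_hasDerivWithinAt_Ici {f f' : ℝ → ℝ} {s a b : ℝ}
    (hf : ∀ x ∈ Icc a b, HasDerivWithinAt f (f' x) (Ici s) x) (hs : s ≤ a)
    (hf' : ∀ x ∈ Icc a b, 0 ≤ f' x) : MonotoneOn f (Icc a b) := by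
  have := antitoneOn_of_hasDerivWithinAt_Ici (f := fun x => -f x) (f' := fun x => -f' x)
    (fun x hx => (hf x hx).fun_neg) hs (fun x hx => by linarith [hf' x hx])
  intro x hx y hy hxy
  have h := this hx hy hxy
  simpa using h

theorem exists_forall_le_of_continuousOn {n : ℕ} {z : Fin n → ℝ → ℝ} {a b : ℝ}
    (hz : ∀ i, ContinuousOn (z i) (Icc a b)) (i₀ : Fin n) (hab : a ≤ b) :
    ∃ i, ∃ x ∈ Icc a b, ∀ j, ∀ y ∈ Icc a b, z i x ≤ z j y := by
  have h1 : ∀ i, ∃ x ∈ Icc a b, ∀ y ∈ Icc a b, z i x ≤ z i y := fun i =>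
    isCompact_Icc.exists_isMinOn (nonempty_Icc.2 hab) (hz i)
  choose x hx hmin using h1
  obtain ⟨i, -, hi⟩ := Finset.exists_min_image Finset.univ (fun i => z i (x i)) ⟨i₀, Finset.mem_univ _⟩
  exact ⟨i, x i, hx i, fun j y hy => (hi j (Finset.mem_univ j)).trans (hmin j y hy)⟩

namespace PhaseModel

variable {n : ℕ} (M : PhaseModel n)

/-- The generator of the discounted surplus process without its drift part. -/
def jumpGen (f : Fin n → ℝ → ℝ) (i : Fin n) (x : ℝ) : ℝ :=
  (∑ j ∈ Finset.univ.erase i, M.T i j * f j x) + M.claimRate i * M.claimTerm f x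
    - (M.leaveRate i + M.δ) * f i x

theorem sum_erase_T (i : Fin n) :
    ∑ j ∈ Finset.univ.erase i, M.T i j = M.leaveRate i - M.claimRate i := by
  rw [leaveRate, claimRate, ← Finset.add_sum_erase _ _ (Finset.mem_univ i)]
  ring

theorem intervalIntegrable_claim {f : Fin n → ℝ → ℝ} (hf : ∀ i, ContinuousOn (f i) (Ici 0)) {x : ℝ}
    (hx : 0 ≤ x) : IntervalIntegrable (fun y => Real.exp (M.β * y) * ∑ i, M.init i * f i y)
      volume 0 x := by
  refine ContinuousOn.intervalIntegrable ?_
  rw [uIcc_of_le hx]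
  have := fun i => (hf i).mono (show Icc 0 x ⊆ Ici 0 from Icc_subset_Ici_self)
  fun_prop

theorem claimTerm_sub {f g : Fin n → ℝ → ℝ} (hf : ∀ i, ContinuousOn (f i) (Ici 0))
    (hg : ∀ i, ContinuousOn (g i) (Ici 0)) {x : ℝ} (hx : 0 ≤ x) :
    M.claimTerm (fun i y => f i y - g i y) x = M.claimTerm f x - M.claimTerm g x := by
  unfold claimTerm
  rw [← mul_sub, ← intervalIntegral.integral_sub (M.intervalIntegrable_claim hf hx)
    (M.intervalIntegrable_claim hg hx)]
  congr 1
  refine intervalIntegral.integral_congr fun y _ => ?_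
  simp only [mul_sub, Finset.sum_sub_distrib]

theorem jumpGen_sub {f g : Fin n → ℝ → ℝ} (hf : ∀ i, ContinuousOn (f i) (Ici 0))
    (hg : ∀ i, ContinuousOn (g i) (Ici 0)) (i : Fin n) {x : ℝ} (hx : 0 ≤ x) :
    M.jumpGen (fun i y => f i y - g i y) i x = M.jumpGen f i x - M.jumpGen g i x := by
  unfold jumpGen
  rw [M.claimTerm_sub hf hg hx]
  simp only [mul_sub, Finset.sum_sub_distrib]
  ring

/-- The claim kernel on [0, x] has mass 1 - exp(-β x) ≤ 1, the rest being ruin; the missing mass is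
harmless only for m ≤ 0. -/
theorem le_claimTerm {z : Fin n → ℝ → ℝ} (hz : ∀ i, ContinuousOn (z i) (Ici 0)) {x m : ℝ}
    (hx : 0 ≤ x) (hm : m ≤ 0) (h : ∀ i, ∀ y ∈ Icc 0 x, m ≤ z i y) : m ≤ M.claimTerm z x := by
  have hβ := M.β_pos
  have h1 : ∫ y in (0 : ℝ)..x, Real.exp (M.β * y) * m
      ≤ ∫ y in (0 : ℝ)..x, Real.exp (M.β * y) * ∑ i, M.init i * z i y := by
    refine intervalIntegral.integral_mono_on hx
      (Continuous.intervalIntegrable (by fun_prop) _ _) (M.intervalIntegrable_claim hz hx) ?_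
    intro y hy
    refine mul_le_mul_of_nonneg_left ?_ (Real.exp_pos _).le
    calc m = ∑ i, M.init i * m := by rw [← Finset.sum_mul, M.init_sum, one_mul]
      _ ≤ _ := Finset.sum_le_sum fun i _ =>
        mul_le_mul_of_nonneg_left (h i y hy) (M.init_nonneg i)
  have h2 : ∫ y in (0 : ℝ)..x, Real.exp (M.β * y) * m = M.β⁻¹ * (Real.exp (M.β * x) - 1) * m := by
    rw [intervalIntegral.integral_mul_const, intervalIntegral.integral_comp_mul_left
      (fun y => Real.exp y) hβ.ne', integral_exp]
    simp
  have he : Real.exp (-M.β * x) * Real.exp (M.β * x) = 1 := by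
    rw [← Real.exp_add]
    simp
  have h3 := mul_le_mul_of_nonneg_left (h2.symm.trans_le h1)
    (mul_pos hβ (Real.exp_pos (-M.β * x))).le
  have h4 : M.β * Real.exp (-M.β * x) * (M.β⁻¹ * (Real.exp (M.β * x) - 1) * m)
      = m - Real.exp (-M.β * x) * m := by
    have hb : M.β * M.β⁻¹ = 1 := mul_inv_cancel₀ hβ.ne'
    linear_combination (Real.exp (-M.β * x) * (Real.exp (M.β * x) - 1) * m) * hb + m * he
  have h5 : Real.exp (-M.β * x) * m ≤ 0 := mul_nonpos_of_nonneg_of_nonpos (Real.exp_pos _).le hm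
  unfold claimTerm
  linarith

/-- Minimum principle for the integro-differential inequality of a barrier strategy. -/
theorem nonneg_of_supersolution {b : Fin n → ℝ} (hb : ∀ i, 0 ≤ b i) {z D : Fin n → ℝ → ℝ}
    (hD : ∀ i x, 0 ≤ x → HasDerivWithinAt (z i) (D i x) (Ici 0) x)
    (habove : ∀ i x, b i ≤ x → 0 ≤ D i x)
    (hbelow : ∀ i x, 0 ≤ x → x ≤ b i → M.c * D i x + M.jumpGen z i x ≤ 0)
    (i : Fin n) {x : ℝ} (hx : 0 ≤ x) : 0 ≤ z i x := by
  by_contra hneg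
  have hc := M.c_pos
  have hδ := M.δ_pos
  have hz : ∀ i, ContinuousOn (z i) (Ici 0) := fun i x hx => (hD i x hx).continuousWithinAt
  obtain ⟨B, hBx, hBb⟩ : ∃ B, x ≤ B ∧ ∀ i, b i ≤ B := by
    refine ⟨x + ∑ i, b i, ?_, fun i => ?_⟩
    · linarith [Finset.sum_nonneg fun i (_ : i ∈ Finset.univ) => hb i]
    · linarith [Finset.single_le_sum (fun i _ => hb i) (Finset.mem_univ i)]
  -- A minimum above its barrier can be moved down to the barrier, since z is nondecreasing there.
  obtain ⟨j, y, hy, hyb, hmin⟩ : ∃ j, ∃ y ∈ Icc 0 B, y ≤ b j ∧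
      ∀ l, ∀ u ∈ Icc 0 B, z j y ≤ z l u := by
    obtain ⟨j, y, hy, hmin⟩ := exists_forall_le_of_continuousOn
      (fun i => (hz i).mono Icc_subset_Ici_self) i (hx.trans hBx)
    rcases le_total y (b j) with h | h
    · exact ⟨j, y, hy, h, hmin⟩
    · refine ⟨j, b j, ⟨hb j, hBb j⟩, le_rfl, fun l u hu => le_trans ?_ (hmin l u hu)⟩
      exact monotoneOn_of_hasDerivWithinAt_Ici (s := 0) (a := b j) (b := B)
        (fun u hu => hD j u ((hb j).trans hu.1)) (hb j) (fun u hu => habove j u hu.1)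
        ⟨le_rfl, hBb j⟩ ⟨h, hy.2⟩ h
  have hm : z j y < 0 := (hmin i x ⟨hx, hBx⟩).trans_lt (not_le.1 hneg)
  -- Comparison with points to the right only, so y = 0 needs no separate treatment.
  have hDj : 0 ≤ D j y := by
    rcases hyb.eq_or_lt with h | h
    · exact habove j y h.ge
    · by_contra hlt
      obtain ⟨ε, hε, h1⟩ := eventually_lt_of_hasDerivWithinAt_pos
        (((hD j y hy.1).mono (Ici_subset_Ici.2 hy.1)).fun_neg) (neg_pos.2 (not_le.1 hlt))
      have hyB : y < B := h.trans_le (hBb j)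
      have h2 := h1 (min (y + ε) B) ⟨lt_min (by linarith) hyB, min_le_left _ _⟩
      have h3 := hmin j (min (y + ε) B) ⟨le_min (by linarith [hy.1]) (hy.1.trans hy.2),
        min_le_right _ _⟩
      linarith
  -- At a global negative minimum the jump terms are at least λ_j z, so the generator is at least -δ
  -- z > 0: this is where discounting gives the contradiction.
  have h1 := M.le_claimTerm hz hy.1 hm.le fun l u hu => hmin l u ⟨hu.1, hu.2.trans hy.2⟩
  have h2 : (M.leaveRate j - M.claimRate j) * z j y
      ≤ ∑ l ∈ Finset.univ.erase j, M.T j l * z l y := by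
    rw [← M.sum_erase_T, Finset.sum_mul]
    exact Finset.sum_le_sum fun l hl => mul_le_mul_of_nonneg_left (hmin l y hy)
      (M.offDiag_nonneg j l (Finset.ne_of_mem_erase hl).symm)
  have h3 : M.claimRate j * z j y ≤ M.claimRate j * M.claimTerm z y :=
    mul_le_mul_of_nonneg_left h1 (M.exit_nonneg j)
  have h4 := hbelow j y hy.1 hyb
  unfold jumpGen at h4
  nlinarith [mul_nonneg hc.le hDj]

/-! ### Perturbing one barrier of an optimal vector. -/

variable {M} {b : Fin n → ℝ}

/-- Otherwise raising b_i by ε would pay off: the gain z is nonnegative by the minimum principle,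
positive at the new barrier, and this positivity is carried down to the old one, where optimality
forbids it. -/
theorem IsOptimalBarrier.not_jumpGen_pos (h : M.IsOptimalBarrier b) (i : Fin n) {ε : ℝ}
    (hε : 0 < ε) : ¬ ∀ x ∈ Ioc (b i) (b i + ε), 0 < M.c + M.jumpGen (M.value b) i x := by
  intro hpos
  obtain ⟨hb, hopt⟩ := h
  have hc := M.c_pos
  have hk : 0 < M.leaveRate i + M.δ := add_pos (M.leaveRate_pos i) M.δ_pos
  set b' := Function.update b i (b i + ε) with hb'def
  have hb'i : b' i = b i + ε := Function.update_self ..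
  have hle : ∀ j, b j ≤ b' j := by
    intro j
    by_cases hj : j = i
    · subst hj
      linarith
    · rw [hb'def, Function.update_of_ne hj]
  have hb' : ∀ j, 0 ≤ b' j := fun j => (hb j).trans (hle j)
  obtain ⟨D, hD, hD1, hDe⟩ := M.exists_deriv_value b hb
  obtain ⟨D', hD', hD1', hDe'⟩ := M.exists_deriv_value b' hb'
  have hf := M.continuousOn_value b hb
  have hf' := M.continuousOn_value b' hb'
  set z : Fin n → ℝ → ℝ := fun j y => M.value b' j y - M.value b j y with hz
  have hzD : ∀ j x, 0 ≤ x → HasDerivWithinAt (z j) (D' j x - D j x) (Ici 0) x :=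
    fun j x hx => (hD' j x hx).fun_sub (hD j x hx)
  have hgen : ∀ j x, 0 ≤ x → x ≤ b' j → M.c * (D' j x - D j x) + M.jumpGen z j x
      = -(M.c * D j x + M.jumpGen (M.value b) j x) := by
    intro j x hx hxb
    have h1 := hDe' j x hx hxb
    rw [hz, M.jumpGen_sub hf' hf j hx]
    unfold jumpGen
    linarith
  have hin : ∀ x ∈ Icc (b i) (b i + ε), 0 ≤ M.c * D i x + M.jumpGen (M.value b) i x := by
    intro x hx
    rcases hx.1.eq_or_lt with h0 | h0
    · have := hDe i x ((hb i).trans hx.1) h0.ge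
      unfold jumpGen
      linarith
    · rw [hD1 i x hx.1, mul_one]
      exact (hpos x ⟨h0, hx.2⟩).le
  have hz0 : ∀ j x, 0 ≤ x → 0 ≤ z j x := by
    intro j x hx
    refine M.nonneg_of_supersolution hb' hzD ?_ ?_ j hx
    · intro j x hx
      rw [hD1' j x hx, hD1 j x ((hle j).trans hx), sub_self]
    · intro j x hx hxb
      rw [hgen j x hx hxb, neg_nonpos]
      rcases le_total x (b j) with h0 | h0
      · have := hDe j x hx h0
        unfold jumpGen
        linarith
      · by_cases hj : j = i
        · subst hj
          exact hin x ⟨h0, hb'i ▸ hxb⟩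
        · have hbj : b' j = b j := Function.update_of_ne hj ..
          have := hDe j x hx (hbj ▸ hxb)
          unfold jumpGen
          linarith
  have hjump : ∀ x, 0 ≤ x → -((M.leaveRate i + M.δ) * z i x) ≤ M.jumpGen z i x := by
    intro x hx
    have hzc : ∀ j, ContinuousOn (z j) (Ici 0) := fun j => (hf' j).sub (hf j)
    have h1 := M.le_claimTerm hzc hx le_rfl fun l u hu => hz0 l u hu.1
    have h2 : 0 ≤ ∑ l ∈ Finset.univ.erase i, M.T i l * z l x :=
      Finset.sum_nonneg fun l hl => mul_nonneg
        (M.offDiag_nonneg i l (Finset.ne_of_mem_erase hl).symm) (hz0 l x hx)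
    have h3 : 0 ≤ M.claimRate i * M.claimTerm z x := mul_nonneg (M.exit_nonneg i) h1
    unfold jumpGen
    linarith
  -- At the new barrier both slopes are 1, so the equation for z has no drift part and its source
  -- must be balanced by z itself.
  have hbi' : 0 < z i (b' i) := by
    have h1 := hgen i (b' i) (hb' i) le_rfl
    rw [hD1' i _ le_rfl, hD1 i _ (hle i), sub_self, mul_zero, zero_add, mul_one] at h1
    have h2 := hpos (b' i) (by rw [hb'i]; exact ⟨by linarith, le_rfl⟩)
    have h3 := hjump (b' i) (hb' i)
    have h4 : 0 < (M.leaveRate i + M.δ) * z i (b' i) := by linarith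
    exact (mul_pos_iff_of_pos_left hk).1 h4
  set κ := (M.leaveRate i + M.δ) / M.c with hκ
  -- The nonnegative jump terms leave c z' ≤ (λ_i + δ) z, a Gronwall inequality that transports
  -- positivity downwards.
  have hanti : AntitoneOn (fun x => Real.exp (-κ * x) * z i x) (Icc (b i) (b i + ε)) := by
    refine antitoneOn_of_hasDerivWithinAt_Ici (s := 0) (f' := fun x => Real.exp (-κ * x) * (-κ * 1)
      * z i x + Real.exp (-κ * x) * (D' i x - D i x)) ?_ (hb i) ?_
    · intro x hx
      exact (((hasDerivAt_id x).const_mul (-κ)).exp.hasDerivWithinAt).mul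
        (hzD i x ((hb i).trans hx.1))
    · intro x hx
      have hx0 := (hb i).trans hx.1
      have h1 := hgen i x hx0 (hb'i ▸ hx.2)
      have h2 := hin x hx
      have h3 := hjump x hx0
      have h4 : D' i x - D i x ≤ κ * z i x := by
        rw [hκ, div_mul_eq_mul_div, le_div_iff₀ hc]
        linarith
      have h5 := mul_le_mul_of_nonneg_left h4 (Real.exp_pos (-κ * x)).le
      linarith
  have h1 := hanti ⟨le_rfl, by linarith⟩ ⟨by linarith, le_rfl⟩ (show b i ≤ b i + ε by linarith)
  simp only at h1
  rw [← hb'i] at h1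
  have h2 : 0 < Real.exp (-κ * b i) * z i (b i) :=
    (mul_pos (Real.exp_pos _) hbi').trans_le h1
  have h3 : 0 < z i (b i) := (mul_pos_iff_of_pos_left (Real.exp_pos _)).1 h2
  have h4 := hopt b' hb' i (b i) ⟨hb i, le_rfl⟩
  simp only [hz] at h3
  linarith

/-- Otherwise lowering b_i by ε would pay off: above the new barrier the new slope 1 exceeds the old
one, so the gain is nonnegative everywhere and strictly increases up to b_i. -/
theorem IsOptimalBarrier.not_deriv_lt_one (h : M.IsOptimalBarrier b) {D : Fin n → ℝ → ℝ}
    (hD : ∀ i x, 0 ≤ x → HasDerivWithinAt (M.value b i) (D i x) (Ici 0) x)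
    (hD1 : ∀ i x, b i ≤ x → D i x = 1)
    (hDe : ∀ i x, 0 ≤ x → x ≤ b i → M.c * D i x + M.jumpGen (M.value b) i x = 0)
    (i : Fin n) {ε : ℝ} (hε : 0 < ε) (hεb : ε ≤ b i) :
    ¬ ∀ x ∈ Ico (b i - ε) (b i), D i x < 1 := by
  intro hlt
  obtain ⟨hb, hopt⟩ := h
  have hc := M.c_pos
  set b' := Function.update b i (b i - ε) with hb'def
  have hb'i : b' i = b i - ε := Function.update_self ..
  have hne : ∀ j, j ≠ i → b' j = b j := fun j hj => Function.update_of_ne hj ..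
  have hle : ∀ j, b' j ≤ b j := by
    intro j
    by_cases hj : j = i
    · subst hj
      linarith
    · rw [hne j hj]
  have hb' : ∀ j, 0 ≤ b' j := by
    intro j
    by_cases hj : j = i
    · subst hj
      linarith
    · rw [hne j hj]
      exact hb j
  obtain ⟨D', hD', hD1', hDe'⟩ := M.exists_deriv_value b' hb'
  have hf := M.continuousOn_value b hb
  have hf' := M.continuousOn_value b' hb'
  set z : Fin n → ℝ → ℝ := fun j y => M.value b' j y - M.value b j y with hz
  have hzD : ∀ j x, 0 ≤ x → HasDerivWithinAt (z j) (D' j x - D j x) (Ici 0) x :=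
    fun j x hx => (hD' j x hx).fun_sub (hD j x hx)
  have hz0 : ∀ j x, 0 ≤ x → 0 ≤ z j x := by
    intro j x hx
    refine M.nonneg_of_supersolution hb' hzD ?_ ?_ j hx
    · intro j x hx
      rw [hD1' j x hx, sub_nonneg]
      rcases lt_or_ge x (b j) with h0 | h0
      · by_cases hj : j = i
        · subst hj
          exact (hlt x ⟨hb'i ▸ hx, h0⟩).le
        · rw [hne j hj] at hx
          exact absurd hx (not_le.2 h0)
      · exact (hD1 j x h0).le
    · intro j x hx hxb
      have h1 := hDe' j x hx hxb
      have h2 := hDe j x hx (hxb.trans (hle j))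
      rw [hz, M.jumpGen_sub hf' hf j hx]
      unfold jumpGen at h2 ⊢
      linarith
  have hmono : StrictMonoOn (z i) (Icc (b i - ε) (b i)) := by
    have hsub : Icc (b i - ε) (b i) ⊆ Ici 0 := fun y hy => le_trans (by linarith) hy.1
    refine strictMonoOn_of_hasDerivWithinAt_pos (convex_Icc _ _) (f' := fun x => D' i x - D i x)
      (fun x hx => ((hzD i x (hsub hx)).mono hsub).continuousWithinAt) (fun x hx => ?_)
      (fun x hx => ?_)
    · exact (hzD i x (hsub (interior_subset hx))).mono (interior_subset.trans hsub)
    · rw [interior_Icc] at hx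
      rw [hD1' i x (hb'i ▸ hx.1.le), sub_pos]
      exact hlt x ⟨hx.1.le, hx.2⟩
  have h1 := hmono ⟨le_rfl, by linarith⟩ ⟨by linarith, le_rfl⟩ (show b i - ε < b i by linarith)
  have h2 := hz0 i (b i - ε) (by linarith)
  have h3 := hopt b' hb' i (b i) ⟨hb i, le_rfl⟩
  simp only [hz] at h1 h2
  linarith

end PhaseModel

/-! ### Sign propagation in linear systems and first-order conditions at a barrier. -/

theorem eventually_lt_of_hasDerivAt_pos_left {f : ℝ → ℝ} {d x : ℝ}
    (h : HasDerivAt f d x) (hd : 0 < d) : ∃ ε > 0, ∀ y ∈ Ico (x - ε) x, f y < f x := by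
  have h1 := (hasDerivWithinAt_iff_tendsto_slope' (notMem_Iio.2 le_rfl)).1
    (h.hasDerivWithinAt (s := Iio x))
  have h2 := h1.eventually (lt_mem_nhds hd)
  obtain ⟨u, hu, hsub⟩ := (mem_nhdsLT_iff_exists_Ico_subset).1 h2
  refine ⟨x - u, sub_pos.2 hu, fun y hy => ?_⟩
  have h3 : 0 < slope f x y := hsub ⟨by linarith [hy.1], hy.2⟩
  rw [slope_comm, slope_def_field] at h3
  have := (div_pos_iff_of_pos_right (sub_pos.2 hy.2)).1 h3
  linarith

/-- A backward linear system with nonnegative off-diagonal coefficients preserves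
nonnegativity. -/
theorem nonneg_of_backward_metzler {n : ℕ} {y : Fin n → ℝ → ℝ} {A : Fin n → Fin n → ℝ} {a b : ℝ}
    (ha : 0 ≤ a) (hA : ∀ i j, i ≠ j → 0 ≤ A i j)
    (hy : ∀ i, ∀ x ∈ Icc a b, HasDerivWithinAt (y i) (-∑ j, A i j * y j x) (Ici 0) x)
    (hb : ∀ i, 0 ≤ y i b) (i : Fin n) {x : ℝ} (hx : x ∈ Icc a b) : 0 ≤ y i x := by
  by_contra hneg
  -- K exceeds every row sum of A, so after multiplication by exp(K x) the derivative at a negative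
  -- minimum over all components is strictly negative.
  set K := 1 + ∑ i, ∑ j, |A i j| with hK
  have hAK : ∀ i, ∑ j, A i j < K := by
    intro i
    have h1 : ∑ j, A i j ≤ ∑ j, |A i j| := Finset.sum_le_sum fun j _ => le_abs_self _
    have h2 : ∑ j, |A i j| ≤ ∑ i, ∑ j, |A i j| := Finset.single_le_sum
      (f := fun i => ∑ j, |A i j|) (fun i _ => Finset.sum_nonneg fun j _ => abs_nonneg _)
      (Finset.mem_univ i)
    linarith
  set Y : Fin n → ℝ → ℝ := fun i x => Real.exp (K * x) * y i x with hY
  have hYD : ∀ i, ∀ x ∈ Icc a b, HasDerivWithinAt (Y i)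
      (K * Y i x - ∑ j, A i j * Y j x) (Ici 0) x := by
    intro i x hx
    refine ((((hasDerivAt_id x).const_mul K).exp.hasDerivWithinAt).mul (hy i x hx)).congr_deriv ?_
    have : ∑ j, A i j * Y j x = Real.exp (K * x) * ∑ j, A i j * y j x := by
      rw [Finset.mul_sum]
      exact Finset.sum_congr rfl fun j _ => by simp only [hY]; ring
    rw [this]
    simp only [hY, id]
    ring
  obtain ⟨j, t, ht, hmin⟩ := exists_forall_le_of_continuousOn (z := Y)
    (fun i x hx => ((hYD i x hx).mono fun u hu => ha.trans hu.1).continuousWithinAt) i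
    (hx.1.trans hx.2)
  have hm : Y j t < 0 := (hmin i x hx).trans_lt (mul_neg_of_pos_of_neg (Real.exp_pos _)
    (not_le.1 hneg))
  have htb : t < b := by
    refine lt_of_le_of_ne ht.2 fun h => ?_
    rw [h] at hm
    exact absurd (mul_nonneg (Real.exp_pos (K * b)).le (hb j)) (not_le.2 hm)
  have hd : 0 ≤ K * Y j t - ∑ l, A j l * Y l t := by
    by_contra hlt
    obtain ⟨ε, hε, h1⟩ := eventually_lt_of_hasDerivWithinAt_pos
      (((hYD j t ht).mono (Ici_subset_Ici.2 (ha.trans ht.1))).fun_neg) (neg_pos.2 (not_le.1 hlt))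
    have h2 := h1 (min (t + ε) b) ⟨lt_min (by linarith) htb, min_le_left _ _⟩
    have h3 := hmin j (min (t + ε) b) ⟨le_min (by linarith [ht.1]) (ht.1.trans ht.2),
      min_le_right _ _⟩
    linarith
  have hs : (∑ l, A j l) * Y j t ≤ ∑ l, A j l * Y l t := by
    rw [Finset.sum_mul]
    refine Finset.sum_le_sum fun l _ => ?_
    by_cases hl : l = j
    · rw [hl]
    · exact mul_le_mul_of_nonneg_left (hmin l t ht) (hA j l (Ne.symm hl))
  nlinarith [hAK j]

/-- First order condition at a barrier that cannot be raised. -/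
theorem slope_le_of_not_raise {c δ l m b G H : ℝ} {f g h : ℝ → ℝ} (hb : 0 ≤ b)
    (hf : HasDerivWithinAt f 1 (Ici 0) b) (hg : HasDerivWithinAt g G (Ici 0) b)
    (hh : HasDerivWithinAt h H (Ici 0) b)
    (he : c + l * g b + m * h b - (l + m + δ) * f b = 0)
    (hR : ∀ ε > 0, ¬ ∀ x ∈ Ioc b (b + ε), 0 < c + l * g x + m * h x - (l + m + δ) * f x) :
    l * G + m * H ≤ l + m + δ := by
  by_contra hlt
  have hd : HasDerivWithinAt (fun x => c + l * g x + m * h x - (l + m + δ) * f x)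
      (l * G + m * H - (l + m + δ) * 1) (Ici 0) b :=
    (((hg.const_mul l).const_add c).fun_add (hh.const_mul m)).fun_sub (hf.const_mul _)
  obtain ⟨ε, hε, h1⟩ := eventually_lt_of_hasDerivWithinAt_pos (hd.mono (Ici_subset_Ici.2 hb))
    (by linarith)
  exact hR ε hε fun x hx => he ▸ h1 x hx

/-- First order condition at a positive barrier that cannot be lowered. -/
theorem le_slope_of_not_lower {c δ l m b G H : ℝ} {f g h D : ℝ → ℝ} (hc : 0 < c) (hb : 0 < b)
    (hf : HasDerivWithinAt f 1 (Ici 0) b) (hg : HasDerivWithinAt g G (Ici 0) b)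
    (hh : HasDerivWithinAt h H (Ici 0) b) (hD : D b = 1)
    (he : ∀ x, 0 ≤ x → x ≤ b → c * D x + l * g x + m * h x - (l + m + δ) * f x = 0)
    (hL : ∀ ε > 0, ε ≤ b → ¬ ∀ x ∈ Ico (b - ε) b, D x < 1) :
    l + m + δ ≤ l * G + m * H := by
  by_contra hlt
  -- On [0, b] the equation identifies this function with c D, so a positive derivative at b would
  -- push D below 1 just to the left.
  have hd : HasDerivAt (fun x => (l + m + δ) * f x - (l * g x + m * h x))
      ((l + m + δ) * 1 - (l * G + m * H)) b :=
    ((hf.const_mul _).fun_sub ((hg.const_mul l).fun_add (hh.const_mul m))).hasDerivAt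
      (Ici_mem_nhds hb)
  obtain ⟨ε, hε, h1⟩ := eventually_lt_of_hasDerivAt_pos_left hd (by linarith)
  refine hL (min ε b) (lt_min hε hb) (min_le_right _ _) fun x hx => ?_
  have hx0 : 0 ≤ x := by linarith [hx.1, min_le_right ε b]
  have h2 := h1 x ⟨by linarith [hx.1, min_le_left ε b], hx.2⟩
  have h3 := he x hx0 hx.2.le
  have h4 := he b hb.le le_rfl
  rw [hD] at h4
  have h5 : c * D x < c * 1 := by linarith
  exact lt_of_mul_lt_mul_left h5 hc.le

/-! ### From the first-order conditions to the dynamic programming equation. -/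

/-- Two value functions with ordered barriers that can neither be raised nor lowered solve the
dynamic programming equation. -/
theorem hjb_of_ordered_barriers {c β δ l₁ m₁ l₂ m₂ π₁ π₂ b₁ b₂ : ℝ} {f₁ f₂ f₃ D₁ D₂ : ℝ → ℝ}
    (hc : 0 < c) (hβ : 0 < β) (hδ : 0 < δ) (hl₁ : 0 ≤ l₁) (hm₁ : 0 ≤ m₁) (hl₂ : 0 ≤ l₂)
    (hm₂ : 0 ≤ m₂) (hπ₁ : 0 ≤ π₁) (hπ₂ : 0 ≤ π₂) (hπ : π₁ + π₂ = 1) (hb₁ : 0 ≤ b₁) (hb : b₁ ≤ b₂)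
    (hf₁ : ∀ x, 0 ≤ x → HasDerivWithinAt f₁ (D₁ x) (Ici 0) x)
    (hf₂ : ∀ x, 0 ≤ x → HasDerivWithinAt f₂ (D₂ x) (Ici 0) x)
    (hf₃ : ∀ x, 0 ≤ x → HasDerivWithinAt f₃ (β * (π₁ * f₁ x + π₂ * f₂ x - f₃ x)) (Ici 0) x)
    (hD₁ : ∀ x, b₁ ≤ x → D₁ x = 1) (hD₂ : ∀ x, b₂ ≤ x → D₂ x = 1)
    (he₁ : ∀ x, 0 ≤ x → x ≤ b₁ → c * D₁ x + l₁ * f₂ x + m₁ * f₃ x - (l₁ + m₁ + δ) * f₁ x = 0)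
    (he₂ : ∀ x, 0 ≤ x → x ≤ b₂ → c * D₂ x + l₂ * f₁ x + m₂ * f₃ x - (l₂ + m₂ + δ) * f₂ x = 0)
    (hR₁ : ∀ ε > 0, ¬ ∀ x ∈ Ioc b₁ (b₁ + ε), 0 < c + l₁ * f₂ x + m₁ * f₃ x - (l₁ + m₁ + δ) * f₁ x)
    (hR₂ : ∀ ε > 0, ¬ ∀ x ∈ Ioc b₂ (b₂ + ε), 0 < c + l₂ * f₁ x + m₂ * f₃ x - (l₂ + m₂ + δ) * f₂ x)
    (hL₁ : ∀ ε > 0, ε ≤ b₁ → ¬ ∀ x ∈ Ico (b₁ - ε) b₁, D₁ x < 1)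
    (hL₂ : ∀ ε > 0, ε ≤ b₂ → ¬ ∀ x ∈ Ico (b₂ - ε) b₂, D₂ x < 1) {x : ℝ} (hx : 0 ≤ x) :
    (1 ≤ D₁ x ∧ c * D₁ x + l₁ * f₂ x + m₁ * f₃ x - (l₁ + m₁ + δ) * f₁ x ≤ 0) ∧
      (1 ≤ D₂ x ∧ c * D₂ x + l₂ * f₁ x + m₂ * f₃ x - (l₂ + m₂ + δ) * f₂ x ≤ 0) := by
  have hb₂ : 0 ≤ b₂ := hb₁.trans hb
  obtain ⟨H, hH⟩ : ∃ H : ℝ → ℝ, H = fun x => β * (π₁ * f₁ x + π₂ * f₂ x - f₃ x) := ⟨_, rfl⟩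
  have hf₃' : ∀ x, 0 ≤ x → HasDerivWithinAt f₃ (H x) (Ici 0) x := by
    intro x hx
    rw [hH]
    exact hf₃ x hx
  have hHD : ∀ x, 0 ≤ x → HasDerivWithinAt H (β * (π₁ * D₁ x + π₂ * D₂ x - H x)) (Ici 0) x := by
    intro x hx
    have := ((((hf₁ x hx).const_mul π₁).fun_add ((hf₂ x hx).const_mul π₂)).fun_sub
      (hf₃' x hx)).const_mul β
    rw [← hH] at this
    exact this
  -- the conditions at the barriers
  have hr₁ : l₁ * D₂ b₁ + m₁ * H b₁ ≤ l₁ + m₁ + δ := by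
    refine slope_le_of_not_raise hb₁ (hD₁ b₁ le_rfl ▸ hf₁ b₁ hb₁) (hf₂ b₁ hb₁) (hf₃' b₁ hb₁) ?_ hR₁
    have := he₁ b₁ hb₁ le_rfl
    rwa [hD₁ b₁ le_rfl, mul_one] at this
  have hr₂ : l₂ * D₁ b₂ + m₂ * H b₂ ≤ l₂ + m₂ + δ := by
    refine slope_le_of_not_raise hb₂ (hD₂ b₂ le_rfl ▸ hf₂ b₂ hb₂) (hf₁ b₂ hb₂) (hf₃' b₂ hb₂) ?_ hR₂
    have := he₂ b₂ hb₂ le_rfl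
    rwa [hD₂ b₂ le_rfl, mul_one] at this
  have hs₁ : 0 < b₁ → l₁ + m₁ + δ ≤ l₁ * D₂ b₁ + m₁ * H b₁ := fun h =>
    le_slope_of_not_lower hc h (hD₁ b₁ le_rfl ▸ hf₁ b₁ hb₁) (hf₂ b₁ hb₁) (hf₃' b₁ hb₁)
      (hD₁ b₁ le_rfl) he₁ hL₁
  have hs₂ : 0 < b₂ → l₂ + m₂ + δ ≤ l₂ * D₁ b₂ + m₂ * H b₂ := fun h =>
    le_slope_of_not_lower hc h (hD₂ b₂ le_rfl ▸ hf₂ b₂ hb₂) (hf₁ b₂ hb₂) (hf₃' b₂ hb₂)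
      (hD₂ b₂ le_rfl) he₂ hL₂
  rw [hD₁ b₂ hb] at hr₂ hs₂
  -- the slopes below the barriers, extended by the equation
  obtain ⟨E₁, hE₁⟩ : ∃ E : ℝ → ℝ, E = fun x => c⁻¹ * ((l₁ + m₁ + δ) * f₁ x
    - (l₁ * f₂ x + m₁ * f₃ x)) := ⟨_, rfl⟩
  obtain ⟨E₂, hE₂⟩ : ∃ E : ℝ → ℝ, E = fun x => c⁻¹ * ((l₂ + m₂ + δ) * f₂ x
    - (l₂ * f₁ x + m₂ * f₃ x)) := ⟨_, rfl⟩
  have hDE₁ : ∀ x, 0 ≤ x → x ≤ b₁ → E₁ x = D₁ x := by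
    intro x h0 h1
    rw [hE₁, inv_mul_eq_iff_eq_mul₀ hc.ne']
    linarith [he₁ x h0 h1]
  have hDE₂ : ∀ x, 0 ≤ x → x ≤ b₂ → E₂ x = D₂ x := by
    intro x h0 h1
    rw [hE₂, inv_mul_eq_iff_eq_mul₀ hc.ne']
    linarith [he₂ x h0 h1]
  have hED₁ : ∀ x, 0 ≤ x → HasDerivWithinAt E₁ (c⁻¹ * ((l₁ + m₁ + δ) * D₁ x
      - (l₁ * D₂ x + m₁ * H x))) (Ici 0) x := by
    intro x hx
    rw [hE₁]
    exact (((hf₁ x hx).const_mul _).fun_sub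
      (((hf₂ x hx).const_mul l₁).fun_add ((hf₃' x hx).const_mul m₁))).const_mul _
  have hED₂ : ∀ x, 0 ≤ x → HasDerivWithinAt E₂ (c⁻¹ * ((l₂ + m₂ + δ) * D₂ x
      - (l₂ * D₁ x + m₂ * H x))) (Ici 0) x := by
    intro x hx
    rw [hE₂]
    exact (((hf₂ x hx).const_mul _).fun_sub
      (((hf₁ x hx).const_mul l₂).fun_add ((hf₃' x hx).const_mul m₂))).const_mul _
  have hci : 0 < c⁻¹ := inv_pos.2 hc
  -- between the barriers
  have hmid : ∀ x ∈ Icc b₁ b₂, 0 < b₂ →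
      0 ≤ c⁻¹ * (l₂ + m₂ * H x - (l₂ + m₂ + δ) * E₂ x) ∧
      c⁻¹ * (l₂ + m₂ * H x - (l₂ + m₂ + δ) * E₂ x) ≤ β * (H x - π₁ - π₂ * E₂ x) := by
    intro x hx hpos
    -- Both slopes are 1 at b₂, so the first-order equality there fixes H b₂; in particular H b₂ >
    -- 1.
    have hmv : m₂ * (H b₂ - 1) = δ := by linarith [hs₂ hpos]
    have hv : 0 < H b₂ - 1 := by
      refine pos_of_mul_pos_right ?_ hm₂
      rw [hmv]
      exact hδ
    have hE2b : E₂ b₂ = 1 := by rw [hDE₂ b₂ hb₂ le_rfl, hD₂ b₂ le_rfl]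
    have hder : ∀ x ∈ Icc b₁ b₂,
        HasDerivWithinAt H (-(β * (H x - π₁ - π₂ * E₂ x))) (Ici 0) x ∧
        HasDerivWithinAt E₂ (-(c⁻¹ * (l₂ + m₂ * H x - (l₂ + m₂ + δ) * E₂ x))) (Ici 0) x := by
      intro x hx
      have hx0 := hb₁.trans hx.1
      refine ⟨(hHD x hx0).congr_deriv ?_, (hED₂ x hx0).congr_deriv ?_⟩
      · rw [hDE₂ x hx0 hx.2, hD₁ x hx.1]
        ring
      · rw [hDE₂ x hx0 hx.2, hD₁ x hx.1]
        ring
    -- With p = -E₂' and q = -H', the pair (p, q) has the coefficient -β π₂ off the diagonal;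
    -- passing to (p, q - p) makes it β π₁ + c⁻¹ (l₂ + δ) ≥ 0, by `hπ`.
    have key := nonneg_of_backward_metzler (n := 2) (a := b₁) (b := b₂)
      (y := ![fun x => c⁻¹ * (l₂ + m₂ * H x - (l₂ + m₂ + δ) * E₂ x),
        fun x => β * (H x - π₁ - π₂ * E₂ x) - c⁻¹ * (l₂ + m₂ * H x - (l₂ + m₂ + δ) * E₂ x)])
      (A := ![![-(c⁻¹ * (l₂ + δ)), c⁻¹ * m₂], ![β * π₁ + c⁻¹ * (l₂ + δ), β - c⁻¹ * m₂]]) hb₁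
      (by
        intro i j hij
        fin_cases i <;> fin_cases j <;> first | exact absurd rfl hij | skip
        · exact mul_nonneg hci.le hm₂
        · exact add_nonneg (mul_nonneg hβ.le hπ₁) (mul_nonneg hci.le (by linarith)))
      (by
        intro i x hx
        obtain ⟨h1, h2⟩ := hder x hx
        have hp := (((h1.const_mul m₂).const_add l₂).fun_sub
          (h2.const_mul (l₂ + m₂ + δ))).const_mul c⁻¹
        have hq := ((h1.sub_const π₁).fun_sub (h2.const_mul π₂)).const_mul β
        fin_cases i
        · refine hp.congr_deriv ?_
          simp [Fin.sum_univ_two]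
          ring
        · refine (hq.fun_sub hp).congr_deriv ?_
          simp [Fin.sum_univ_two]
          linear_combination (β * c⁻¹ * (l₂ + m₂ * H x - (l₂ + m₂ + δ) * E₂ x)) * hπ)
      (by
        intro i
        have hp : l₂ + m₂ * H b₂ - (l₂ + m₂ + δ) * 1 = 0 := by linarith
        fin_cases i
        · simp [hE2b]
          rw [mul_one] at hp
          rw [hp, mul_zero]
        · simp [hE2b]
          rw [mul_one] at hp
          rw [hp, mul_zero]
          exact mul_nonneg hβ.le (by linarith))
    have k0 := key 0 hx
    have k1 := key 1 hx
    simp at k0 k1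
    exact ⟨k0, k1⟩
  have hE₂anti : 0 < b₂ → AntitoneOn E₂ (Icc b₁ b₂) := by
    intro hpos
    refine antitoneOn_of_hasDerivWithinAt_Ici (fun x hx => hED₂ x (hb₁.trans hx.1)) hb₁ ?_
    intro x hx
    have := (hmid x hx hpos).1
    rw [hDE₂ x (hb₁.trans hx.1) hx.2] at this
    rw [hD₁ x hx.1]
    linarith
  have hHanti : 0 < b₂ → AntitoneOn H (Icc b₁ b₂) := by
    intro hpos
    refine antitoneOn_of_hasDerivWithinAt_Ici (fun x hx => hHD x (hb₁.trans hx.1)) hb₁ ?_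
    intro x hx
    have := (hmid x hx hpos).1.trans (hmid x hx hpos).2
    rw [hDE₂ x (hb₁.trans hx.1) hx.2] at this
    rw [hD₁ x hx.1]
    linarith
  have hD₂mid : ∀ x ∈ Icc b₁ b₂, 1 ≤ D₂ x := by
    intro x hx
    rcases hb₂.eq_or_lt with h0 | hpos
    · rw [hD₂ x (by linarith [hx.1])]
    · rw [← hDE₂ x (hb₁.trans hx.1) hx.2, ← hD₂ b₂ le_rfl, ← hDE₂ b₂ hb₂ le_rfl]
      exact hE₂anti hpos hx ⟨hb, le_rfl⟩ hx.2
  -- the generator of the first phase between the barriers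
  have hslope : ∀ x ∈ Icc b₁ b₂, l₁ * D₂ x + m₁ * H x ≤ l₁ + m₁ + δ := by
    intro x hx
    rcases hb₂.eq_or_lt with h0 | hpos
    · have : x = b₁ := by linarith [hx.1, hx.2]
      rw [this]
      exact hr₁
    · refine le_trans ?_ hr₁
      rw [← hDE₂ x (hb₁.trans hx.1) hx.2, ← hDE₂ b₁ hb₁ hb]
      exact add_le_add
        (mul_le_mul_of_nonneg_left (hE₂anti hpos ⟨le_rfl, hb⟩ hx hx.1) hl₁)
        (mul_le_mul_of_nonneg_left (hHanti hpos ⟨le_rfl, hb⟩ hx hx.1) hm₁)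
  obtain ⟨γ₁, hγ₁⟩ : ∃ γ : ℝ → ℝ, γ = fun x => c + l₁ * f₂ x + m₁ * f₃ x
    - (l₁ + m₁ + δ) * f₁ x := ⟨_, rfl⟩
  obtain ⟨γ₂, hγ₂⟩ : ∃ γ : ℝ → ℝ, γ = fun x => c + l₂ * f₁ x + m₂ * f₃ x
    - (l₂ + m₂ + δ) * f₂ x := ⟨_, rfl⟩
  have hγD₁ : ∀ x, 0 ≤ x → HasDerivWithinAt γ₁ (l₁ * D₂ x + m₁ * H x
      - (l₁ + m₁ + δ) * D₁ x) (Ici 0) x := by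
    intro x hx
    rw [hγ₁]
    exact ((((hf₂ x hx).const_mul l₁).const_add c).fun_add ((hf₃' x hx).const_mul m₁)).fun_sub
      ((hf₁ x hx).const_mul _)
  have hγD₂ : ∀ x, 0 ≤ x → HasDerivWithinAt γ₂ (l₂ * D₁ x + m₂ * H x
      - (l₂ + m₂ + δ) * D₂ x) (Ici 0) x := by
    intro x hx
    rw [hγ₂]
    exact ((((hf₁ x hx).const_mul l₂).const_add c).fun_add ((hf₃' x hx).const_mul m₂)).fun_sub
      ((hf₂ x hx).const_mul _)
  have hγb₁ : γ₁ b₁ = 0 := by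
    have := he₁ b₁ hb₁ le_rfl
    rw [hD₁ b₁ le_rfl, mul_one] at this
    rw [hγ₁]
    exact this
  have hγb₂ : γ₂ b₂ = 0 := by
    have := he₂ b₂ hb₂ le_rfl
    rw [hD₂ b₂ le_rfl, mul_one] at this
    rw [hγ₂]
    exact this
  -- above both barriers
  have htail : ∀ m, 0 ≤ m → m * (H b₂ - 1) ≤ δ → ∀ x, b₂ ≤ x → m * (H x - 1) ≤ δ := by
    intro m hm hmb x hx
    -- Above both barriers H' = β (1 - H), so the integrating factor leaves the derivative β δ exp(β
    -- x) ≥ 0.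
    have hmono : MonotoneOn (fun x => Real.exp (β * x) * (δ - m * (H x - 1))) (Icc b₂ x) := by
      refine monotoneOn_of_hasDerivWithinAt_Ici (s := 0) (fun y hy =>
        (((hasDerivAt_id y).const_mul β).exp.hasDerivWithinAt).mul
          ((((hHD y (hb₂.trans hy.1)).sub_const 1).const_mul m).const_sub δ)) hb₂ ?_
      intro y hy
      rw [hD₁ y (hb.trans hy.1), hD₂ y hy.1]
      have : Real.exp (β * id y) * (β * 1) * (δ - m * (H y - 1)) + Real.exp (β * id y) *
          -(m * (β * (π₁ * 1 + π₂ * 1 - H y))) = Real.exp (β * y) * (β * δ) := by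
        simp only [id]
        linear_combination (-Real.exp (β * y) * m * β) * hπ
      rw [this]
      positivity
    have h1 := hmono ⟨le_rfl, hx⟩ ⟨hx, le_rfl⟩ hx
    simp only at h1
    have h2 : 0 ≤ Real.exp (β * b₂) * (δ - m * (H b₂ - 1)) :=
      mul_nonneg (Real.exp_pos _).le (by linarith)
    have h3 := nonneg_of_mul_nonneg_right (h2.trans h1) (Real.exp_pos _)
    linarith
  have ht₁ : m₁ * (H b₂ - 1) ≤ δ := by
    have := hslope b₂ ⟨hb, le_rfl⟩
    rw [hD₂ b₂ le_rfl] at this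
    linarith
  have ht₂ : m₂ * (H b₂ - 1) ≤ δ := by linarith
  have hγ₁le : ∀ x, b₁ ≤ x → γ₁ x ≤ 0 := by
    intro x hx
    rw [← hγb₁]
    refine antitoneOn_of_hasDerivWithinAt_Ici (s := 0) (a := b₁) (b := x)
      (fun y hy => hγD₁ y (hb₁.trans hy.1)) hb₁ ?_ ⟨le_rfl, hx⟩ ⟨hx, le_rfl⟩ hx
    intro y hy
    rw [hD₁ y hy.1]
    rcases le_total y b₂ with h | h
    · linarith [hslope y ⟨hy.1, h⟩]
    · rw [hD₂ y h]
      linarith [htail m₁ hm₁ ht₁ y h]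
  have hγ₂le : ∀ x, b₂ ≤ x → γ₂ x ≤ 0 := by
    intro x hx
    rw [← hγb₂]
    refine antitoneOn_of_hasDerivWithinAt_Ici (s := 0) (a := b₂) (b := x)
      (fun y hy => hγD₂ y (hb₂.trans hy.1)) hb₂ ?_ ⟨le_rfl, hx⟩ ⟨hx, le_rfl⟩ hx
    intro y hy
    rw [hD₁ y (hb.trans hy.1), hD₂ y hy.1]
    linarith [htail m₂ hm₂ ht₂ y hy.1]
  -- below both barriers
  have hlow : ∀ x ∈ Icc 0 b₁, 1 ≤ D₁ x ∧ 1 ≤ D₂ x := by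
    intro x hx
    rcases hb₁.eq_or_lt with h0 | hpos
    · have hxb : x = b₁ := by linarith [hx.1, hx.2]
      rw [hxb]
      exact ⟨(hD₁ b₁ le_rfl).ge, hD₂mid b₁ ⟨le_rfl, hb⟩⟩
    have hE1b : E₁ b₁ = 1 := by rw [hDE₁ b₁ hb₁ le_rfl, hD₁ b₁ le_rfl]
    have hp1b : l₁ * E₂ b₁ + m₁ * H b₁ - (l₁ + m₁ + δ) = 0 := by
      rw [hDE₂ b₁ hb₁ hb]
      linarith [hs₁ hpos]
    obtain ⟨hmid0, hmid1⟩ := hmid b₁ ⟨le_rfl, hb⟩ (hpos.trans_le hb)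
    obtain ⟨p₁, hp₁⟩ : ∃ p : ℝ → ℝ, p = fun x => c⁻¹ * (l₁ * E₂ x + m₁ * H x
      - (l₁ + m₁ + δ) * E₁ x) := ⟨_, rfl⟩
    obtain ⟨p₂, hp₂⟩ : ∃ p : ℝ → ℝ, p = fun x => c⁻¹ * (l₂ * E₁ x + m₂ * H x
      - (l₂ + m₂ + δ) * E₂ x) := ⟨_, rfl⟩
    obtain ⟨q, hq⟩ : ∃ q : ℝ → ℝ, q = fun x => β * (H x - (π₁ * E₁ x + π₂ * E₂ x)) := ⟨_, rfl⟩
    have hder : ∀ x ∈ Icc 0 b₁, HasDerivWithinAt H (-q x) (Ici 0) x ∧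
        HasDerivWithinAt E₁ (-p₁ x) (Ici 0) x ∧ HasDerivWithinAt E₂ (-p₂ x) (Ici 0) x := by
      intro x hx
      have h1 := hDE₁ x hx.1 hx.2
      have h2 := hDE₂ x hx.1 (hx.2.trans hb)
      refine ⟨(hHD x hx.1).congr_deriv ?_, (hED₁ x hx.1).congr_deriv ?_,
        (hED₂ x hx.1).congr_deriv ?_⟩
      · rw [hq, ← h1, ← h2]
        ring
      · rw [hp₁, ← h1, ← h2]
        ring
      · rw [hp₂, ← h1, ← h2]
        ring
    have hp₁D : ∀ x ∈ Icc 0 b₁, HasDerivWithinAt p₁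
        (c⁻¹ * (l₁ * -p₂ x + m₁ * -q x - (l₁ + m₁ + δ) * -p₁ x)) (Ici 0) x := by
      intro x hx
      obtain ⟨h1, h2, h3⟩ := hder x hx
      have := (((h3.const_mul l₁).fun_add (h1.const_mul m₁)).fun_sub
        (h2.const_mul (l₁ + m₁ + δ))).const_mul c⁻¹
      rwa [← hp₁] at this
    have hp₂D : ∀ x ∈ Icc 0 b₁, HasDerivWithinAt p₂
        (c⁻¹ * (l₂ * -p₁ x + m₂ * -q x - (l₂ + m₂ + δ) * -p₂ x)) (Ici 0) x := by
      intro x hx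
      obtain ⟨h1, h2, h3⟩ := hder x hx
      have := (((h2.const_mul l₂).fun_add (h1.const_mul m₂)).fun_sub
        (h3.const_mul (l₂ + m₂ + δ))).const_mul c⁻¹
      rwa [← hp₂] at this
    have hqD : ∀ x ∈ Icc 0 b₁, HasDerivWithinAt q
        (β * (-q x - (π₁ * -p₁ x + π₂ * -p₂ x))) (Ici 0) x := by
      intro x hx
      obtain ⟨h1, h2, h3⟩ := hder x hx
      have := (h1.fun_sub ((h2.const_mul π₁).fun_add (h3.const_mul π₂))).const_mul β
      rwa [← hq] at this
    have hp1b' : p₁ b₁ = 0 := by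
      rw [hp₁]
      simp only [hE1b, mul_one, hp1b, mul_zero]
    have hp2b' : p₂ b₁ = c⁻¹ * (l₂ + m₂ * H b₁ - (l₂ + m₂ + δ) * E₂ b₁) := by
      rw [hp₂]
      simp only [hE1b, mul_one]
    have hqb' : q b₁ = β * (H b₁ - π₁ - π₂ * E₂ b₁) := by
      rw [hq]
      simp only [hE1b, mul_one]
      ring
    -- Now p₁ and p₂ both vary. Carrying q - p₁ and q - p₂ as redundant unknowns makes all
    -- off-diagonal coefficients nonnegative; l₁ (p₁ - p₂), for instance, is written as l₁ (q - p₂)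
    -- - l₁ (q - p₁).
    have key := nonneg_of_backward_metzler (n := 4) (a := 0) (b := b₁)
      (y := ![p₁, p₂, fun x => q x - p₁ x, fun x => q x - p₂ x])
      (A := ![![-(c⁻¹ * (l₁ + δ)), c⁻¹ * l₁, c⁻¹ * m₁, 0],
        ![c⁻¹ * l₂, -(c⁻¹ * (l₂ + δ)), 0, c⁻¹ * m₂],
        ![c⁻¹ * δ, 0, β * π₁ - c⁻¹ * (l₁ + m₁), β * π₂ + c⁻¹ * l₁],
        ![0, c⁻¹ * δ, β * π₁ + c⁻¹ * l₂, β * π₂ - c⁻¹ * (l₂ + m₂)]]) le_rfl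
      (by
        intro i j hij
        fin_cases i <;> fin_cases j <;> first | exact absurd rfl hij | (simp; try positivity))
      (by
        intro i x hx
        have h1 := hp₁D x hx
        have h2 := hp₂D x hx
        have h3 := hqD x hx
        fin_cases i
        · refine h1.congr_deriv ?_
          simp [Fin.sum_univ_four]
          ring
        · refine h2.congr_deriv ?_
          simp [Fin.sum_univ_four]
          ring
        · refine (h3.fun_sub h1).congr_deriv ?_
          simp [Fin.sum_univ_four]
          linear_combination (β * q x) * hπ
        · refine (h3.fun_sub h2).congr_deriv ?_
          simp [Fin.sum_univ_four]
          linear_combination (β * q x) * hπ)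
      -- At b₁, p₁ vanishes by the first-order equality, while p₂ and q match the values from the
      -- interval between the barriers, where 0 ≤ p₂ ≤ q.
      (by
        intro i
        fin_cases i
        · exact hp1b'.ge
        · change 0 ≤ p₂ b₁
          rw [hp2b']
          exact hmid0
        · change 0 ≤ q b₁ - p₁ b₁
          rw [hp1b', hqb']
          linarith
        · change 0 ≤ q b₁ - p₂ b₁
          rw [hp2b', hqb']
          linarith)
    have hanti₁ : AntitoneOn E₁ (Icc 0 b₁) :=
      antitoneOn_of_hasDerivWithinAt_Ici (fun y hy => (hder y hy).2.1) le_rfl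
        fun y hy => neg_nonpos.2 (key 0 hy)
    have hanti₂ : AntitoneOn E₂ (Icc 0 b₁) :=
      antitoneOn_of_hasDerivWithinAt_Ici (fun y hy => (hder y hy).2.2) le_rfl
        fun y hy => neg_nonpos.2 (key 1 hy)
    rw [← hDE₁ x hx.1 hx.2, ← hDE₂ x hx.1 (hx.2.trans hb)]
    refine ⟨hE1b ▸ hanti₁ hx ⟨hb₁, le_rfl⟩ hx.2, ?_⟩
    refine le_trans ?_ (hanti₂ hx ⟨hb₁, le_rfl⟩ hx.2)
    rw [hDE₂ b₁ hb₁ hb]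
    exact hD₂mid b₁ ⟨le_rfl, hb⟩
  rw [hγ₁] at hγ₁le
  rw [hγ₂] at hγ₂le
  refine ⟨⟨?_, ?_⟩, ?_, ?_⟩
  · rcases le_total x b₁ with h | h
    · exact (hlow x ⟨hx, h⟩).1
    · exact (hD₁ x h).ge
  · rcases le_total x b₁ with h | h
    · exact (he₁ x hx h).le
    · rw [hD₁ x h, mul_one]
      exact hγ₁le x h
  · rcases le_total x b₁ with h | h
    · exact (hlow x ⟨hx, h⟩).2
    · rcases le_total x b₂ with h' | h'
      · exact hD₂mid x ⟨h, h'⟩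
      · exact (hD₂ x h').ge
  · rcases le_total x b₂ with h | h
    · exact (he₂ x hx h).le
    · rw [hD₂ x h, mul_one]
      exact hγ₂le x h

/-! ### Specialization to two phases and conclusion. -/

namespace PhaseModel

variable {M : PhaseModel 2} {b : Fin 2 → ℝ}

/-- With two phases the sum over the other phases has one term and λ_i = λ_ij + λ_i3. Stating this
for an arbitrary ordered pair of phases lets either barrier be the lower one. -/
theorem IsOptimalBarrier.one_le_deriv_and_gen_nonpos (h : M.IsOptimalBarrier b)
    {D : Fin 2 → ℝ → ℝ}
    (hD : ∀ i x, 0 ≤ x → HasDerivWithinAt (M.value b i) (D i x) (Ici 0) x)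
    (hD1 : ∀ i x, b i ≤ x → D i x = 1)
    (hDe : ∀ i x, 0 ≤ x → x ≤ b i → M.c * D i x + M.jumpGen (M.value b) i x = 0)
    {i j : Fin 2} (hij : i ≠ j) (hle : b i ≤ b j) {x : ℝ} (hx : 0 ≤ x) :
    (1 ≤ D i x ∧ M.c * D i x + M.jumpGen (M.value b) i x ≤ 0) ∧
      (1 ≤ D j x ∧ M.c * D j x + M.jumpGen (M.value b) j x ≤ 0) := by
  have he : ∀ p q : Fin 2, p ≠ q → Finset.univ.erase p = {q} := by decide
  have hei := he i j hij
  have hej := he j i hij.symm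
  have hsum : ∀ F : Fin 2 → ℝ, ∑ k, F k = F i + F j := fun F => by
    rw [← Finset.add_sum_erase _ _ (Finset.mem_univ i), hei, Finset.sum_singleton]
  have hri : M.leaveRate i = M.T i j + M.claimRate i := by
    have := M.sum_erase_T i
    rw [hei, Finset.sum_singleton] at this
    linarith
  have hrj : M.leaveRate j = M.T j i + M.claimRate j := by
    have := M.sum_erase_T j
    rw [hej, Finset.sum_singleton] at this
    linarith
  have hgi : ∀ a y, a + M.jumpGen (M.value b) i y = a + M.T i j * M.value b j y +
      M.claimRate i * M.claimTerm (M.value b) y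
        - (M.T i j + M.claimRate i + M.δ) * M.value b i y := by
    intro a y
    rw [jumpGen, hei, Finset.sum_singleton, hri]
    ring
  have hgj : ∀ a y, a + M.jumpGen (M.value b) j y = a + M.T j i * M.value b i y +
      M.claimRate j * M.claimTerm (M.value b) y
        - (M.T j i + M.claimRate j + M.δ) * M.value b j y := by
    intro a y
    rw [jumpGen, hej, Finset.sum_singleton, hrj]
    ring
  have hRi := fun ε (hε : 0 < ε) => h.not_jumpGen_pos i hε
  have hRj := fun ε (hε : 0 < ε) => h.not_jumpGen_pos j hε
  have hei' := hDe i
  have hej' := hDe j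
  simp only [hgi] at hRi hei' ⊢
  simp only [hgj] at hRj hej' ⊢
  refine hjb_of_ordered_barriers M.c_pos M.β_pos M.δ_pos (M.offDiag_nonneg i j hij)
    (M.exit_nonneg i) (M.offDiag_nonneg j i hij.symm) (M.exit_nonneg j) (M.init_nonneg i)
    (M.init_nonneg j) ?_ (h.1 i) hle (hD i) (hD j) ?_ (hD1 i) (hD1 j) hei' hej' hRi hRj
    (fun ε hε hεb => h.not_deriv_lt_one hD hD1 hDe i hε hεb)
    (fun ε hε hεb => h.not_deriv_lt_one hD hD1 hDe j hε hεb) hx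
  · rw [← hsum]
    exact M.init_sum
  · intro y hy
    rw [← hsum fun k => M.init k * M.value b k y]
    exact M.hasDerivWithinAt_claimTerm (M.continuousOn_value b h.1) hy

end PhaseModel

end

theorem mainTheorem2 (M : PhaseModel 2) (b : Fin 2 → ℝ) (hb : M.IsOptimalBarrier b)
    (i : Fin 2) (x : ℝ) (hx : 0 ≤ x) :
    ∃ d : ℝ, HasDerivWithinAt (M.value b i) d (Set.Ici 0) x ∧
      max
        (M.c * d + (∑ j ∈ Finset.univ.erase i, M.T i j * M.value b j x)
          + M.claimRate i * M.claimTerm (M.value b) x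
          - (M.leaveRate i + M.δ) * M.value b i x)
        (1 - d) = 0 := by
  obtain ⟨D, hD, hD1, hDe⟩ := M.exists_deriv_value b hb.1
  have hDe' : ∀ i x, 0 ≤ x → x ≤ b i → M.c * D i x + M.jumpGen (M.value b) i x = 0 := by
    intro i x hx hxb
    rw [← hDe i x hx hxb, PhaseModel.jumpGen]
    ring
  have key : 1 ≤ D i x ∧ M.c * D i x + M.jumpGen (M.value b) i x ≤ 0 := by
    obtain ⟨j, hij⟩ := exists_ne i
    rcases le_total (b i) (b j) with h | h
    · exact (hb.one_le_deriv_and_gen_nonpos hD hD1 hDe' hij.symm h hx).1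
    · exact (hb.one_le_deriv_and_gen_nonpos hD hD1 hDe' hij h hx).2
  have hgen : M.c * D i x + (∑ j ∈ Finset.univ.erase i, M.T i j * M.value b j x)
      + M.claimRate i * M.claimTerm (M.value b) x - (M.leaveRate i + M.δ) * M.value b i x
      = M.c * D i x + M.jumpGen (M.value b) i x := by
    rw [PhaseModel.jumpGen]
    ring
  refine ⟨D i x, hD i x hx, ?_⟩
  rw [hgen]
  -- Complementarity: the generator vanishes up to the barrier, and the slope is 1 from the barrier
  -- on.
  rcases le_total x (b i) with h | h
  · rw [hDe' i x hx h]
    exact max_eq_left (by linarith [key.1])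
  · rw [hD1 i x h, sub_self, ← hD1 i x h]
    exact max_eq_right key.2
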